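/- Let $X_1,X_2,\dots$ be independent real random variables on a common probability space such that $E(X_j)=0$, $E(X_j^2)=1$ and $E(|X_j|^3)\le M$ for all $j\ge 1$, where $M<\infty$ does not depend on $j$. For $n\ge 1$ let $$I_n(\lambda)=\frac1n\Big|\sum_{j=1}^n e^{-ij\lambda}X_j\Big|^2,\qquad \lambda\in\mathbb R,$$ be the periodogram, let $r_n=\lfloor\frac{n-1}{2}\rfloor$, and for $n\ge 3$ let $$F_n(x)=\frac1{r_n}\sum_{k=1}^{r_n}1_{\{I_n(2\pi k/n)\le x\}}$$ be its (random) empirical distribution function. Then, with probability $1$, $$\sup_{x\ge 0}\big|F_n(x)-(1-e^{-x})\big|\to 0\qquad (n\to\infty).$$ -/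

import Mathlib

open MeasureTheory ProbabilityTheory Filter Topology

/-- The periodogram `I_n(θ) = n⁻¹ |∑_{j=1}^n e^{-i j θ} x_j|²` of a real sequence `x_1, x_2, …`.
The sequence is stored with its first term at index `0`, i.e. `x j` is the term `x_{j+1}`. -/
noncomputable def periodogram (x : ℕ → ℝ) (n : ℕ) (θ : ℝ) : ℝ :=
  (1 / (n : ℝ)) *
    ‖∑ j ∈ Finset.range n, Complex.exp (-Complex.I * ((j + 1 : ℕ) : ℂ) * (θ : ℂ)) * (x j : ℂ)‖ ^ 2

/-- The number `r_n = ⌊(n - 1) / 2⌋` of frequencies (for `n ≥ 1`). -/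
def numFreq (n : ℕ) : ℕ := (n - 1) / 2

/-- The empirical CDF `F_n(t) = r_n⁻¹ ∑_{k=1}^{r_n} 1_{I_n(2πk/n) ≤ t}` of the periodogram
at the frequencies `2πk/n`, `1 ≤ k ≤ r_n` (meaningful for `n ≥ 3`, where `r_n ≥ 1`). -/
noncomputable def periodogramCDF (x : ℕ → ℝ) (n : ℕ) (t : ℝ) : ℝ :=
  (1 / (numFreq n : ℝ)) * ∑ k ∈ Finset.Icc 1 (numFreq n),
    if periodogram x n (2 * Real.pi * (k : ℝ) / (n : ℝ)) ≤ t then (1 : ℝ) else 0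

/-! Write the periodogram ordinates as `|Z_k|²`, with `Z_k` the Fourier coefficients normalized by
`n^{-1/2}`. It suffices that almost surely the empirical measure of the points `Z_k` in the plane
converges weakly to the circular Gaussian law, which gives the disc of radius `√t` mass `1 - e^{-t}`
and charges no circle. Pólya's argument then makes the convergence uniform.

By Lévy's theorem, weak convergence reduces to averages over `k` of `cos(⟪Z_k, ξ⟫ + α)`, with `α =
0` and `α = -π/2` giving real and imaginary parts. The coefficient vectors of the forms `⟪Z_k, ξ⟫`
are orthogonal in `k`, have squared norm `‖ξ‖²/2`, and have entries of order `n^{-1/2}`. Three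
estimates give convergence of such averages (`ae_tendsto_cosMean`).

Expectation: a characteristic-function CLT, whose error is controlled by the third moments
(`abs_integral_cosMean_sub_le`).

Fluctuation: for variables truncated at `K`, orthogonality makes the squared coordinate increments
of the average sum to `O(1/n)` (`sum_sq_cosMean_update_le`). Efron–Stein would then give a variance
`O(1/n)`, which is not summable; a second application, to the square, gives a fourth central moment
`O(1/n²)` (`fourth_central_moment_le`), and Borel–Cantelli applies.

Truncation: Bessel's inequality bounds the squared error by a multiple of the mean of the discarded
squares. A one-sided law of large numbers (`ae_eventually_sum_sqTail_le`) makes this `O((M + 1)/K)`,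
and `K` is then taken large.

The exceptional null set depends on `ξ`. A countable dense set of directions suffices, since Bessel
also gives a Lipschitz bound in `ξ`. -/

/-! ### Efron–Stein inequality and fourth central moments -/

lemma integrable_of_measurable_bounded {α : Type*} [MeasurableSpace α] {μ : Measure α}
    [IsFiniteMeasure μ] {f : α → ℝ} (hf : Measurable f) {B : ℝ} (hB : ∀ x, |f x| ≤ B) :
    Integrable f μ :=
  Integrable.of_bound hf.aestronglyMeasurable B (.of_forall hB)

lemma abs_sub_sq_le {u v B : ℝ} (hu : |u| ≤ B) (hv : |v| ≤ B) : |(u - v) ^ 2| ≤ (2 * B) ^ 2 := by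
  rw [abs_of_nonneg (sq_nonneg _), ← sq_abs]
  have := abs_sub u v
  gcongr
  linarith

lemma abs_sq_le {u B : ℝ} (hu : |u| ≤ B) : |u ^ 2| ≤ B ^ 2 := by
  rw [abs_pow]
  gcongr

lemma integral_sub_const_sq {α : Type*} [MeasurableSpace α] {μ : Measure α}
    [IsProbabilityMeasure μ] {f : α → ℝ} (hf : Measurable f) {B : ℝ} (hB : ∀ x, |f x| ≤ B)
    (c : ℝ) :
    ∫ x, (f x - c) ^ 2 ∂μ = ∫ x, f x ^ 2 ∂μ - 2 * c * ∫ x, f x ∂μ + c ^ 2 := by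
  have h1 : Integrable (fun x => 2 * c * f x) μ :=
    (integrable_of_measurable_bounded hf hB).const_mul _
  have h2 : Integrable (fun x => f x ^ 2) μ :=
    integrable_of_measurable_bounded (hf.pow_const 2) (fun x => abs_sq_le (hB x))
  have h3 : Integrable (fun x => f x ^ 2 - 2 * c * f x) μ := h2.sub h1
  have : ∀ x, (f x - c) ^ 2 = f x ^ 2 - 2 * c * f x + c ^ 2 := fun x => by ring
  simp_rw [this]
  rw [integral_add h3 (integrable_const _), integral_sub h2 h1, integral_const_mul]
  simp

/-- The variance is at most the second moment around any point. -/
lemma integral_sq_sub_sq_integral_le {α : Type*} [MeasurableSpace α] {μ : Measure α}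
    [IsProbabilityMeasure μ] {f : α → ℝ} (hf : Measurable f) {B : ℝ} (hB : ∀ x, |f x| ≤ B)
    (c : ℝ) : ∫ x, f x ^ 2 ∂μ - (∫ x, f x ∂μ) ^ 2 ≤ ∫ x, (f x - c) ^ 2 ∂μ := by
  rw [integral_sub_const_sq hf hB]
  nlinarith [sq_nonneg (∫ x, f x ∂μ - c)]

lemma sq_integral_le_integral_sq {α : Type*} [MeasurableSpace α] {μ : Measure α}
    [IsProbabilityMeasure μ] {f : α → ℝ} (hf : Measurable f) {B : ℝ} (hB : ∀ x, |f x| ≤ B) :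
    (∫ x, f x ∂μ) ^ 2 ≤ ∫ x, f x ^ 2 ∂μ := by
  have h4 : 0 ≤ ∫ x, (f x - ∫ y, f y ∂μ) ^ 2 ∂μ := integral_nonneg fun x => sq_nonneg _
  rw [integral_sub_const_sq hf hB] at h4
  nlinarith

lemma measurable_cons_fin {n : ℕ} :
    Measurable fun z : ℝ × (Fin n → ℝ) => (Fin.cons z.1 z.2 : Fin (n + 1) → ℝ) := by
  refine measurable_pi_lambda _ fun i => ?_
  refine Fin.cases ?_ (fun j => ?_) i
  · simpa using measurable_fst
  · simp only [Fin.cons_succ]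
    exact (measurable_pi_apply j).comp measurable_snd

lemma integral_pi_fin_succ {n : ℕ} (μ : Fin (n + 1) → Measure ℝ)
    [∀ i, IsProbabilityMeasure (μ i)] {F : (Fin (n + 1) → ℝ) → ℝ} (hF : Measurable F) {B : ℝ}
    (hB : ∀ x, |F x| ≤ B) :
    ∫ x, F x ∂(Measure.pi μ)
      = ∫ y, ∫ a, F (Fin.cons a y) ∂(μ 0) ∂(Measure.pi fun j : Fin n => μ j.succ) := by
  have h := (measurePreserving_piFinSuccAbove μ 0).symm
  have h1 := h.integral_comp' (g := F)
  rw [← h1]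
  have h2 : ∀ z : ℝ × (Fin n → ℝ),
      (MeasurableEquiv.piFinSuccAbove (fun _ : Fin (n + 1) => ℝ) 0).symm z
        = Fin.cons z.1 z.2 := by
    intro z
    simp [MeasurableEquiv.piFinSuccAbove, Fin.insertNthEquiv]
  simp_rw [h2]
  exact integral_prod_symm _
    (integrable_of_measurable_bounded (hF.comp measurable_cons_fin) fun z => hB _)

/-- **Efron–Stein inequality** for bounded functions on a finite product of probability spaces. -/
theorem efron_stein (n : ℕ) : ∀ (μ : Fin n → Measure ℝ) [∀ i, IsProbabilityMeasure (μ i)]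
    {F : (Fin n → ℝ) → ℝ} (_ : Measurable F) {B : ℝ} (_ : ∀ x, |F x| ≤ B),
    ∫ x, F x ^ 2 ∂(Measure.pi μ) - (∫ x, F x ∂(Measure.pi μ)) ^ 2
      ≤ ∑ j, ∫ x, (F x - F (Function.update x j 0)) ^ 2 ∂(Measure.pi μ) := by
  induction n with
  | zero =>
    intro μ _ F hF B hB
    have hc : ∀ x, F x = F 0 := fun x => congrArg F (Subsingleton.elim _ _)
    have h1 : ∀ c : ℝ, ∫ _x : Fin 0 → ℝ, c ∂(Measure.pi μ) = c := by
      intro c; rw [integral_const]; simp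
    simp_rw [hc]
    rw [h1, h1]; simp
  | succ n ih =>
    intro μ _ F hF B hB
    set ν : Measure (Fin n → ℝ) := Measure.pi fun j : Fin n => μ j.succ with hν
    have hFc : Measurable fun z : ℝ × (Fin n → ℝ) => F (Fin.cons z.1 z.2) :=
      hF.comp measurable_cons_fin
    -- Law of total variance: the variance of `F` is the mean of its conditional variance in
    -- coordinate `0` plus the variance of `g`, to which the induction hypothesis applies.
    set g : (Fin n → ℝ) → ℝ := fun y => ∫ a, F (Fin.cons a y) ∂(μ 0) with hg
    have hgm : Measurable g := by
      exact (hFc.stronglyMeasurable.integral_prod_left' (μ := μ 0)).measurable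
    have hFy : ∀ y, Measurable fun a => F (Fin.cons a y) := fun y =>
      hFc.comp (measurable_id.prodMk measurable_const)
    have hgB : ∀ y, |g y| ≤ B := by
      intro y
      have := norm_integral_le_of_norm_le_const (μ := μ 0) (f := fun a => F (Fin.cons a y))
        (C := B) (.of_forall fun a => hB _)
      simpa using this
    have hIH := ih (fun j => μ j.succ) hgm hgB
    rw [Fin.sum_univ_succ]
    have hupd : ∀ j : Fin (n + 1), Measurable fun x : Fin (n + 1) → ℝ => Function.update x j 0 := by
      intro j
      fun_prop
    have hdm : ∀ j, Measurable fun x => (F x - F (Function.update x j 0)) ^ 2 := fun j =>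
      (hF.sub (hF.comp (hupd j))).pow_const 2
    have hdB : ∀ j x, |(F x - F (Function.update x j 0)) ^ 2| ≤ (2 * B) ^ 2 := fun j x =>
      abs_sub_sq_le (hB _) (hB _)
    rw [integral_pi_fin_succ μ (hF.pow_const 2) (fun x => abs_sq_le (hB x)),
      integral_pi_fin_succ μ hF hB, integral_pi_fin_succ μ (hdm 0) (hdB 0)]
    simp_rw [fun j : Fin n => integral_pi_fin_succ μ (hdm j.succ) (hdB j.succ)]
    simp only [← Fin.cons_update, Fin.update_cons_zero]
    have hmi : ∀ {f : (ℝ × (Fin n → ℝ)) → ℝ} (_ : Measurable f) {C : ℝ} (_ : ∀ z, |f z| ≤ C),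
        Integrable (fun y => ∫ a, f (a, y) ∂(μ 0)) ν := by
      intro f hf C hC
      refine integrable_of_measurable_bounded (B := C) ?_ ?_
      · exact (hf.stronglyMeasurable.integral_prod_left' (μ := μ 0)).measurable
      · intro y
        have := norm_integral_le_of_norm_le_const (μ := μ 0) (f := fun a => f (a, y))
          (C := C) (.of_forall fun a => hC _)
        simpa using this
    have i1 : Integrable (fun y => ∫ a, F (Fin.cons a y) ^ 2 ∂(μ 0)) ν :=
      hmi (hFc.pow_const 2) (fun z => abs_sq_le (hB _))
    have i2 : Integrable (fun y => g y ^ 2) ν :=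
      integrable_of_measurable_bounded (hgm.pow_const 2) (fun y => abs_sq_le (hgB y))
    have hF0 : Measurable fun z : ℝ × (Fin n → ℝ) => F (Fin.cons 0 z.2) :=
      hFc.comp (measurable_const.prodMk measurable_snd)
    have i3 : Integrable (fun y => ∫ a, (F (Fin.cons a y) - F (Fin.cons 0 y)) ^ 2 ∂(μ 0)) ν :=
      hmi ((hFc.sub hF0).pow_const 2) (fun z => abs_sub_sq_le (hB _) (hB _))
    -- The value at `0` serves as centre because a variance is at most the second moment about any
    -- point not depending on `a`; no independent copy is needed.
    have e1 : ∫ y, ∫ a, F (Fin.cons a y) ^ 2 ∂(μ 0) ∂ν - ∫ y, g y ^ 2 ∂ν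
        ≤ ∫ y, ∫ a, (F (Fin.cons a y) - F (Fin.cons 0 y)) ^ 2 ∂(μ 0) ∂ν := by
      rw [← integral_sub i1 i2]
      refine integral_mono (i1.sub i2) i3 fun y => ?_
      exact integral_sq_sub_sq_integral_le (hFy y) (fun a => hB _) _
    -- Jensen: increments of `g` are averages over `a` of increments of `F`.
    have e2 : ∑ j : Fin n, ∫ y, (g y - g (Function.update y j 0)) ^ 2 ∂ν
        ≤ ∑ j : Fin n, ∫ y, ∫ a, (F (Fin.cons a y) - F (Fin.cons a (Function.update y j 0))) ^ 2
          ∂(μ 0) ∂ν := by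
      refine Finset.sum_le_sum fun j _ => ?_
      have hu : Measurable fun y : Fin n → ℝ => Function.update y j 0 := by fun_prop
      have hFu : Measurable fun z : ℝ × (Fin n → ℝ) =>
          F (Fin.cons z.1 (Function.update z.2 j 0)) :=
        hFc.comp (measurable_fst.prodMk (hu.comp measurable_snd))
      refine integral_mono ?_ ?_ fun y => ?_
      · exact integrable_of_measurable_bounded ((hgm.sub (hgm.comp hu)).pow_const 2)
          (fun y => abs_sub_sq_le (hgB _) (hgB _))
      · exact hmi ((hFc.sub hFu).pow_const 2) (fun z => abs_sub_sq_le (hB _) (hB _))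
      · simp only [hg]
        rw [← integral_sub (integrable_of_measurable_bounded (hFy y) fun a => hB _)
          (integrable_of_measurable_bounded (hFy _) fun a => hB _)]
        refine sq_integral_le_integral_sq (B := 2 * B) ((hFy y).sub (hFy _)) fun a => ?_
        have := abs_sub (F (Fin.cons a y)) (F (Fin.cons a (Function.update y j 0)))
        linarith [hB (Fin.cons a y), hB (Fin.cons a (Function.update y j 0))]
    linarith [hIH, e1, e2]

/-- Iterating the Efron–Stein inequality: a function whose squared coordinate increments sum to at
most `D` everywhere has fourth central moment of order `D ^ 2`. -/
theorem fourth_central_moment_le {n : ℕ} (μ : Fin n → Measure ℝ) [∀ i, IsProbabilityMeasure (μ i)]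
    {F : (Fin n → ℝ) → ℝ} (hF : Measurable F) {B : ℝ} (hB : ∀ x, |F x| ≤ B) {D : ℝ}
    (hD : ∀ x, ∑ j, (F x - F (Function.update x j 0)) ^ 2 ≤ D) :
    ∫ x, (F x - ∫ y, F y ∂(Measure.pi μ)) ^ 4 ∂(Measure.pi μ) ≤ 11 * D ^ 2 := by
  set π := Measure.pi μ
  set c := ∫ y, F y ∂π with hc
  have hD0 : 0 ≤ D := (Finset.sum_nonneg fun j _ => sq_nonneg _).trans (hD 0)
  have hcB : |c| ≤ B := by
    have := norm_integral_le_of_norm_le_const (μ := π) (f := F) (C := B) (.of_forall hB)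
    simpa using this
  set H : (Fin n → ℝ) → ℝ := fun x => F x - c with hH
  have hHm : Measurable H := hF.sub measurable_const
  have hHB : ∀ x, |H x| ≤ 2 * B := fun x => by
    have := abs_sub (F x) c
    linarith [hB x]
  have hHd : ∀ x j, H x - H (Function.update x j 0) = F x - F (Function.update x j 0) := by
    intro x j; simp [hH]
  have hiF : Integrable F π := integrable_of_measurable_bounded hF hB
  have hH0 : ∫ x, H x ∂π = 0 := by
    simp only [hH]
    rw [integral_sub hiF (integrable_const _)]
    simp [hc]
  have hupd : ∀ j : Fin n, Measurable fun x : Fin n → ℝ => Function.update x j 0 := by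
    intro j
    fun_prop
  have hint : ∀ {f : (Fin n → ℝ) → ℝ} (_ : Measurable f) {C : ℝ} (_ : ∀ x, |f x| ≤ C),
    Integrable f π := fun hf _ hC => integrable_of_measurable_bounded hf hC
  have v2 : ∫ x, H x ^ 2 ∂π ≤ D := by
    have := efron_stein n μ hHm hHB
    change ∫ x, H x ^ 2 ∂π - (∫ x, H x ∂π) ^ 2 ≤ _ at this
    rw [hH0] at this
    simp_rw [hHd] at this
    rw [← integral_finsetSum] at this
    · have h2 : ∫ x, ∑ j, (F x - F (Function.update x j 0)) ^ 2 ∂π ≤ ∫ _x, D ∂π := by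
        refine integral_mono_of_nonneg (.of_forall fun x => Finset.sum_nonneg fun j _ => sq_nonneg _)
          (integrable_const _) (.of_forall hD)
      simp only [integral_const, probReal_univ, smul_eq_mul, one_mul] at h2
      linarith
    · intro j _
      exact hint ((hF.sub (hF.comp (hupd j))).pow_const 2) (fun x => abs_sub_sq_le (hB _) (hB _))
  have hH2B : ∀ x, |H x ^ 2| ≤ (2 * B) ^ 2 := fun x => abs_sq_le (hHB x)
  -- Second application, to `H²`: the fourth moment is at most `(E H²)²` plus the increments of
  -- `H²`, which factor as `d_j (2H - d_j)`.
  have v4 := efron_stein n μ (hHm.pow_const 2) hH2B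
  change ∫ x, (H x ^ 2) ^ 2 ∂π - (∫ x, H x ^ 2 ∂π) ^ 2 ≤
    ∑ j, ∫ x, (H x ^ 2 - H (Function.update x j 0) ^ 2) ^ 2 ∂π at v4
  rw [← integral_finsetSum] at v4
  swap
  · intro j _
    exact hint (((hHm.pow_const 2).sub ((hHm.comp (hupd j)).pow_const 2)).pow_const 2)
      (fun x => abs_sub_sq_le (hH2B _) (hH2B _))
  have hpt : ∀ x, ∑ j, (H x ^ 2 - H (Function.update x j 0) ^ 2) ^ 2
      ≤ 8 * D * H x ^ 2 + 2 * D ^ 2 := by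
    intro x
    set d : Fin n → ℝ := fun j => F x - F (Function.update x j 0) with hd
    have hdj : ∀ j, d j ^ 2 ≤ D := fun j =>
      (Finset.single_le_sum (f := fun j => d j ^ 2) (fun i _ => sq_nonneg _)
        (Finset.mem_univ j)).trans (hD x)
    calc ∑ j, (H x ^ 2 - H (Function.update x j 0) ^ 2) ^ 2
        ≤ ∑ j, (8 * H x ^ 2 + 2 * D) * d j ^ 2 := by
          refine Finset.sum_le_sum fun j _ => ?_
          have h1 : H (Function.update x j 0) = H x - d j := by
            simp only [hd, ← hHd]; ring
          rw [h1]
          have h2 : (H x ^ 2 - (H x - d j) ^ 2) ^ 2 = d j ^ 2 * (2 * H x - d j) ^ 2 := by ring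
          rw [h2]
          have h3 : (2 * H x - d j) ^ 2 ≤ 8 * H x ^ 2 + 2 * D := by
            nlinarith [sq_nonneg (2 * H x + d j), hdj j]
          rw [mul_comm]
          exact mul_le_mul_of_nonneg_right h3 (sq_nonneg _)
      _ = (8 * H x ^ 2 + 2 * D) * ∑ j, d j ^ 2 := by rw [Finset.mul_sum]
      _ ≤ (8 * H x ^ 2 + 2 * D) * D := by
          exact mul_le_mul_of_nonneg_left (hD x) (by positivity)
      _ = _ := by ring
  have iH2 : Integrable (fun x => H x ^ 2) π := hint (hHm.pow_const 2) hH2B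
  have h5 : ∫ x, ∑ j, (H x ^ 2 - H (Function.update x j 0) ^ 2) ^ 2 ∂π
      ≤ 8 * D * ∫ x, H x ^ 2 ∂π + 2 * D ^ 2 := by
    have := integral_mono_of_nonneg (μ := π)
      (.of_forall fun x => Finset.sum_nonneg fun j _ => sq_nonneg _)
      ((iH2.const_mul (8 * D)).add (integrable_const (2 * D ^ 2))) (.of_forall hpt)
    refine this.trans (le_of_eq ?_)
    simp only [Pi.add_apply]
    rw [integral_add (iH2.const_mul _) (integrable_const _), integral_const_mul]
    simp
  have h6 : 0 ≤ ∫ x, H x ^ 2 ∂π := integral_nonneg fun x => sq_nonneg _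
  have h7 : ∀ x, (F x - c) ^ 4 = (H x ^ 2) ^ 2 := fun x => by simp only [hH]; ring
  simp_rw [h7]
  -- The constant is `11 = 1 + 8 + 2`: `D²` from `(E H²)²`, and `8D · D + 2D²` from the increments.
  nlinarith [mul_le_mul_of_nonneg_left v2 hD0, mul_le_mul v2 v2 h6 hD0]

/-! ### Averages of cosines of orthogonal linear forms -/

lemma abs_self_sub_sin_le_two_mul_sq (t : ℝ) : |t - Real.sin t| ≤ 2 * t ^ 2 := by
  wlog h : 0 ≤ t generalizing t with H
  · have := H (-t) (by linarith)
    rw [Real.sin_neg, ← abs_neg] at this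
    convert this using 1
    · congr 1; ring
    · ring
  have h1 := Real.sin_le h
  rw [abs_of_nonneg (by linarith)]
  rcases h.eq_or_lt with rfl | h0
  · simp
  rcases le_or_gt t 1 with h2 | h2
  · have := Real.sin_gt_sub_cube h0
    nlinarith [sq_nonneg t]
  · nlinarith [Real.neg_one_le_sin t]

/-- Isolating the term linear in `t` lets orthogonality act on its sum over frequencies; only the
quadratic remainder is bounded termwise. -/
lemma abs_cos_sub_cos_sub_add_le (u t : ℝ) :
    |Real.cos u - Real.cos (u - t) + t * Real.sin u| ≤ 3 * t ^ 2 := by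
  have h : Real.cos u - Real.cos (u - t) + t * Real.sin u
      = Real.cos u * (1 - Real.cos t) + Real.sin u * (t - Real.sin t) := by
    rw [Real.cos_sub]; ring
  rw [h]
  refine (abs_add_le _ _).trans ?_
  rw [abs_mul, abs_mul]
  have h1 : |1 - Real.cos t| ≤ t ^ 2 := by
    rw [abs_of_nonneg (by linarith [Real.cos_le_one t])]
    nlinarith [Real.one_sub_sq_div_two_le_cos (x := t)]
  have h2 := abs_self_sub_sin_le_two_mul_sq t
  have h3 := Real.abs_cos_le_one u
  have h4 := Real.abs_sin_le_one u
  nlinarith [mul_le_mul h3 h1 (abs_nonneg _) zero_le_one, mul_le_mul h4 h2 (abs_nonneg _) zero_le_one]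

section Orthogonal

variable {ι κ : Type*} [Fintype ι] {s : Finset κ} {a : ι → κ → ℝ} {v : ℝ}

/-- Parseval: the cross terms of the expanded square cancel. With `y` the sines of the forms, it
bounds the gradient of `cosMean`. -/
lemma sum_sq_of_orthogonal [DecidableEq κ]
    (h : ∀ k ∈ s, ∀ l ∈ s, ∑ j, a j k * a j l = if k = l then v else 0) (y : κ → ℝ) :
    ∑ j, (∑ k ∈ s, a j k * y k) ^ 2 = v * ∑ k ∈ s, y k ^ 2 := by
  calc ∑ j, (∑ k ∈ s, a j k * y k) ^ 2
      = ∑ j, ∑ k ∈ s, ∑ l ∈ s, (y k * y l) * (a j k * a j l) := by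
        refine Finset.sum_congr rfl fun j _ => ?_
        rw [sq, Finset.sum_mul_sum]
        refine Finset.sum_congr rfl fun k _ => Finset.sum_congr rfl fun l _ => by ring
    _ = ∑ k ∈ s, ∑ l ∈ s, (y k * y l) * ∑ j, a j k * a j l := by
        rw [Finset.sum_comm]
        refine Finset.sum_congr rfl fun k _ => ?_
        rw [Finset.sum_comm]
        refine Finset.sum_congr rfl fun l _ => by rw [Finset.mul_sum]
    _ = v * ∑ k ∈ s, y k ^ 2 := by
        rw [Finset.mul_sum]
        refine Finset.sum_congr rfl fun k hk => ?_
        rw [Finset.sum_congr rfl fun l hl => by rw [h k hk l hl]]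
        simp [hk]
        ring

/-- Bessel's inequality for an orthogonal family of vectors of equal norm. -/
lemma bessel_of_orthogonal [DecidableEq κ] (hv : 0 ≤ v)
    (h : ∀ k ∈ s, ∀ l ∈ s, ∑ j, a j k * a j l = if k = l then v else 0) (x : ι → ℝ) :
    ∑ k ∈ s, (∑ j, a j k * x j) ^ 2 ≤ v * ∑ j, x j ^ 2 := by
  set y : κ → ℝ := fun k => ∑ j, a j k * x j with hy
  set S := ∑ k ∈ s, y k ^ 2 with hS
  have hS0 : 0 ≤ S := Finset.sum_nonneg fun _ _ => sq_nonneg _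
  have hx0 : 0 ≤ ∑ j, x j ^ 2 := Finset.sum_nonneg fun _ _ => sq_nonneg _
  -- Duality: `S` pairs `x` with `∑ y_k a_k`, whose squared norm is `v S`. Cauchy–Schwarz gives `S²
  -- ≤ ‖x‖² v S`, and one factor `S` cancels.
  have h1 : S = ∑ j, x j * ∑ k ∈ s, a j k * y k := by
    simp_rw [Finset.mul_sum]
    rw [Finset.sum_comm]
    refine Finset.sum_congr rfl fun k _ => ?_
    rw [sq]
    nth_rw 1 [hy]
    simp only
    rw [Finset.sum_mul]
    refine Finset.sum_congr rfl fun j _ => by ring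
  have h2 : S ^ 2 ≤ (∑ j, x j ^ 2) * (v * S) := by
    rw [← sum_sq_of_orthogonal h y]
    nth_rw 1 [h1]
    exact Finset.sum_mul_sq_le_sq_mul_sq _ _ _
  rcases hS0.eq_or_lt with h0 | h0
  · rw [← h0]
    positivity
  · nlinarith

/-- The mean over `s` of the cosines of the linear forms with coefficients `a`, shifted by `α`. -/
noncomputable def cosMean (s : Finset κ) (a : ι → κ → ℝ) (α : ℝ) (x : ι → ℝ) : ℝ :=
  (1 / (s.card : ℝ)) * ∑ k ∈ s, Real.cos (∑ j, a j k * x j + α)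

lemma measurable_cosMean (α : ℝ) : Measurable (cosMean s a α) := by
  unfold cosMean
  fun_prop

lemma abs_mean_le {f : κ → ℝ} {C : ℝ} (hC : 0 ≤ C) (hf : ∀ k ∈ s, |f k| ≤ C) :
    |(1 / (s.card : ℝ)) * ∑ k ∈ s, f k| ≤ C := by
  rw [abs_mul, abs_of_nonneg (by positivity)]
  have h : |∑ k ∈ s, f k| ≤ s.card * C := by
    refine (Finset.abs_sum_le_sum_abs _ _).trans ((Finset.sum_le_sum hf).trans (le_of_eq ?_))
    rw [Finset.sum_const, nsmul_eq_mul]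
  rcases s.card.eq_zero_or_pos with h0 | h0
  · simp [h0, hC]
  · have : (0 : ℝ) < s.card := by exact_mod_cast h0
    rw [one_div, inv_mul_le_iff₀ this]
    exact h

lemma abs_cosMean_le (α : ℝ) (x : ι → ℝ) : |cosMean s a α x| ≤ 1 :=
  abs_mean_le zero_le_one fun _ _ => Real.abs_cos_le_one _

lemma sq_mean_le (f : κ → ℝ) :
    ((1 / (s.card : ℝ)) * ∑ k ∈ s, f k) ^ 2 ≤ (1 / (s.card : ℝ)) * ∑ k ∈ s, f k ^ 2 := by
  have h := sq_sum_le_card_mul_sum_sq (s := s) (f := f)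
  rcases s.card.eq_zero_or_pos with h0 | h0
  · simp [h0]
  · have : (0 : ℝ) < s.card := by exact_mod_cast h0
    rw [mul_pow, div_pow, one_pow]
    calc 1 / (s.card : ℝ) ^ 2 * (∑ k ∈ s, f k) ^ 2
        ≤ 1 / (s.card : ℝ) ^ 2 * (s.card * ∑ k ∈ s, f k ^ 2) := by gcongr
      _ = _ := by field_simp

/-- The average of cosines is Lipschitz in the Euclidean norm. -/
lemma sq_cosMean_sub_le [DecidableEq κ] (hv : 0 ≤ v)
    (h : ∀ k ∈ s, ∀ l ∈ s, ∑ j, a j k * a j l = if k = l then v else 0) (α : ℝ) (x y : ι → ℝ) :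
    (cosMean s a α x - cosMean s a α y) ^ 2 ≤ v / s.card * ∑ j, (x j - y j) ^ 2 := by
  have h1 : cosMean s a α x - cosMean s a α y = (1 / (s.card : ℝ)) * ∑ k ∈ s,
      (Real.cos (∑ j, a j k * x j + α) - Real.cos (∑ j, a j k * y j + α)) := by
    simp only [cosMean]
    rw [← mul_sub, Finset.sum_sub_distrib]
  rw [h1]
  refine (sq_mean_le _).trans ?_
  have h2 : ∑ k ∈ s, (Real.cos (∑ j, a j k * x j + α) - Real.cos (∑ j, a j k * y j + α)) ^ 2
      ≤ ∑ k ∈ s, (∑ j, a j k * (x j - y j)) ^ 2 := by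
    refine Finset.sum_le_sum fun k _ => ?_
    rw [sq_le_sq]
    refine (Real.abs_cos_sub_cos_le _ _).trans (le_of_eq ?_)
    congr 1
    simp_rw [mul_sub, Finset.sum_sub_distrib]
    ring
  calc _ ≤ (1 / (s.card : ℝ)) * (v * ∑ j, (x j - y j) ^ 2) := by
        gcongr
        exact h2.trans (bessel_of_orthogonal hv h _)
    _ = _ := by ring

/-- Setting one coordinate to zero changes the average of cosines, in the sum of squares over the
coordinates, by at most a quantity of the order of the inverse dimension. -/
lemma sum_sq_cosMean_update_le [DecidableEq κ] [DecidableEq ι] (hv : 0 ≤ v)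
    (h : ∀ k ∈ s, ∀ l ∈ s, ∑ j, a j k * a j l = if k = l then v else 0) {b : ℝ}
    (hb : ∀ j, ∀ k ∈ s, |a j k| ≤ b) (α : ℝ) {K : ℝ} {x : ι → ℝ}
    (hx : ∀ j, |x j| ≤ K) :
    ∑ j, (cosMean s a α x - cosMean s a α (Function.update x j 0)) ^ 2
      ≤ 2 * K ^ 2 * v / s.card + 18 * Fintype.card ι * b ^ 4 * K ^ 4 := by
  set r : ℝ := (s.card : ℝ) with hr
  set L : κ → ℝ := fun k => ∑ j, a j k * x j + α with hL
  set S : ι → ℝ := fun j => ∑ k ∈ s, a j k * Real.sin (L k) with hS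
  have hLu : ∀ j k, ∑ i, a i k * Function.update x j 0 i + α = L k - a j k * x j := by
    intro j k
    simp only [hL]
    rw [← Finset.add_sum_erase _ _ (Finset.mem_univ j),
      ← Finset.add_sum_erase (Finset.univ) (fun i => a i k * x i) (Finset.mem_univ j)]
    rw [Finset.sum_congr rfl fun i hi => by
      rw [Function.update_of_ne (Finset.ne_of_mem_erase hi)]]
    simp
    ring
  -- The increment is a gradient term `-(x_j / r) S_j` plus a Taylor remainder of size at most
  -- `3b²K²`; then `(p + q)² ≤ 2p² + 2q²` gives `18 = 2 · 9`.
  have hpt : ∀ j, (cosMean s a α x - cosMean s a α (Function.update x j 0)) ^ 2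
      ≤ 2 * (K ^ 2 / r ^ 2) * S j ^ 2 + 18 * b ^ 4 * K ^ 4 := by
    intro j
    have hK2 : x j ^ 2 ≤ K ^ 2 := by
      rw [← sq_abs]
      exact pow_le_pow_left₀ (abs_nonneg _) (hx j) 2
    set R : ℝ := (1 / r) * ∑ k ∈ s, (Real.cos (L k) - Real.cos (L k - a j k * x j)
      + (a j k * x j) * Real.sin (L k)) with hR
    have e1 : cosMean s a α x - cosMean s a α (Function.update x j 0)
        = -(x j / r) * S j + R := by
      simp only [cosMean, hLu, hR, hS, Finset.sum_add_distrib, Finset.sum_sub_distrib,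
        Finset.mul_sum, mul_add, mul_sub]
      rw [add_comm, add_assoc, left_eq_add, ← Finset.sum_add_distrib]
      exact Finset.sum_eq_zero fun k _ => by ring
    have e2 : |R| ≤ 3 * (b ^ 2 * K ^ 2) := by
      refine abs_mean_le (by positivity) fun k hk => ?_
      refine (abs_cos_sub_cos_sub_add_le _ _).trans ?_
      rw [mul_pow]
      have : a j k ^ 2 ≤ b ^ 2 := by
        rw [← sq_abs]
        exact pow_le_pow_left₀ (abs_nonneg _) (hb j k hk) 2
      gcongr
    have e3 : R ^ 2 ≤ 9 * b ^ 4 * K ^ 4 := by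
      rw [← sq_abs]
      calc |R| ^ 2 ≤ (3 * (b ^ 2 * K ^ 2)) ^ 2 := by gcongr
        _ = _ := by ring
    rw [e1]
    have e4 : (-(x j / r) * S j) ^ 2 ≤ (K ^ 2 / r ^ 2) * S j ^ 2 := by
      rw [mul_pow, neg_sq, div_pow]
      gcongr
    nlinarith [sq_nonneg (-(x j / r) * S j - R)]
  refine (Finset.sum_le_sum fun j _ => hpt j).trans ?_
  -- The decisive gain: orthogonality gives `∑ S_j² ≤ v r`. The termwise bound `S_j² ≤ r² b²` would
  -- give `O(1)` instead of `O(1/n)` when `b` is of order `n^{-1/2}`.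
  rw [Finset.sum_add_distrib, ← Finset.mul_sum, sum_sq_of_orthogonal h]
  have h5 : ∑ k ∈ s, Real.sin (L k) ^ 2 ≤ r := by
    calc ∑ k ∈ s, Real.sin (L k) ^ 2 ≤ ∑ k ∈ s, 1 :=
          Finset.sum_le_sum fun k _ => Real.sin_sq_le_one _
      _ = r := by simp [hr]
  have h6 : 2 * (K ^ 2 / r ^ 2) * (v * ∑ k ∈ s, Real.sin (L k) ^ 2) ≤ 2 * K ^ 2 * v / r := by
    calc _ ≤ 2 * (K ^ 2 / r ^ 2) * (v * r) := by gcongr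
      _ = 2 * K ^ 2 * v / r := by
        rcases eq_or_ne r 0 with h0 | h0
        · simp [h0]
        · field_simp
  simp only [Finset.sum_const, Finset.card_univ, nsmul_eq_mul]
  nlinarith

end Orthogonal

/-! ### A quantitative CLT for characteristic functions -/

lemma norm_cexp_mul_I_sub_taylor_two_le (t : ℝ) :
    ‖Complex.exp (t * Complex.I) - (1 + t * Complex.I - t ^ 2 / 2)‖ ≤ 4 * |t| ^ 3 := by
  rcases le_or_gt |t| 1 with h | h
  · have h1 : ‖(t * Complex.I : ℂ)‖ = |t| := by simp
    have h2 := Complex.exp_bound (x := t * Complex.I) (by rw [h1]; exact h) (n := 3) (by norm_num)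
    rw [h1] at h2
    have h3 : ∑ m ∈ Finset.range 3, (t * Complex.I : ℂ) ^ m / (m.factorial : ℂ)
        = 1 + t * Complex.I - t ^ 2 / 2 := by
      simp [Finset.sum_range_succ, Nat.factorial, mul_pow]
      ring
    rw [h3] at h2
    refine h2.trans ?_
    have : (0 : ℝ) ≤ |t| ^ 3 := by positivity
    norm_num [Nat.factorial]
    nlinarith
  · have h1 : ‖Complex.exp (t * Complex.I) - (1 + t * Complex.I - t ^ 2 / 2)‖
        ≤ ‖Complex.exp (t * Complex.I)‖ + (‖(1 : ℂ)‖ + ‖(t * Complex.I : ℂ)‖ + ‖(t ^ 2 / 2 : ℂ)‖) :=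
      (norm_sub_le _ _).trans (add_le_add le_rfl
        ((norm_sub_le _ _).trans (add_le_add (norm_add_le _ _) le_rfl)))
    rw [Complex.norm_exp_ofReal_mul_I] at h1
    have h2 : ‖(t * Complex.I : ℂ)‖ = |t| := by simp
    have h3 : ‖(t ^ 2 / 2 : ℂ)‖ = |t| ^ 2 / 2 := by simp
    rw [h2, h3, norm_one] at h1
    nlinarith [mul_pos (sub_pos.2 h) (sub_pos.2 h), mul_pos (sub_pos.2 h) (pow_pos (zero_lt_one.trans h) 2)]

lemma abs_exp_neg_sub_one_sub_le {u : ℝ} (hu : 0 ≤ u) : |Real.exp (-u) - (1 - u)| ≤ u ^ 2 := by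
  have h1 := Real.add_one_le_exp (-u)
  rw [abs_of_nonneg (by linarith)]
  rcases le_or_gt u 1 with h | h
  · have := Real.norm_exp_sub_one_sub_id_le (x := -u) (by simpa [abs_of_nonneg hu] using h)
    rw [Real.norm_eq_abs, Real.norm_eq_abs, sq_abs] at this
    have := (abs_le.1 this).2
    nlinarith
  · have : Real.exp (-u) ≤ 1 := Real.exp_le_one_iff.2 (by linarith)
    nlinarith

/-- Telescoping: factors are exchanged one at a time, the others having norm at most `1`. -/
lemma norm_prod_sub_prod_le {ι : Type*} (s : Finset ι) (z w : ι → ℂ) (hz : ∀ i ∈ s, ‖z i‖ ≤ 1)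
    (hw : ∀ i ∈ s, ‖w i‖ ≤ 1) : ‖∏ i ∈ s, z i - ∏ i ∈ s, w i‖ ≤ ∑ i ∈ s, ‖z i - w i‖ := by
  classical
  induction s using Finset.induction_on with
  | empty => simp
  | insert i s hi ih =>
    rw [Finset.prod_insert hi, Finset.prod_insert hi, Finset.sum_insert hi]
    have h1 : z i * ∏ j ∈ s, z j - w i * ∏ j ∈ s, w j
        = (z i - w i) * ∏ j ∈ s, z j + w i * (∏ j ∈ s, z j - ∏ j ∈ s, w j) := by ring
    rw [h1]
    refine (norm_add_le _ _).trans (add_le_add ?_ ?_)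
    · rw [norm_mul, norm_prod]
      exact mul_le_of_le_one_right (norm_nonneg _)
        (Finset.prod_le_one (fun _ _ => norm_nonneg _)
          fun j hj => hz j (Finset.mem_insert_of_mem hj))
    · rw [norm_mul]
      exact (mul_le_of_le_one_left (norm_nonneg _) (hw i (Finset.mem_insert_self _ _))).trans
        (ih (fun j hj => hz j (Finset.mem_insert_of_mem hj))
          fun j hj => hw j (Finset.mem_insert_of_mem hj))

section Clt

variable {Ω : Type*} [MeasurableSpace Ω] {P : Measure Ω} [IsProbabilityMeasure P]

lemma integrable_pow_of_integrable_abs_pow_three {X : Ω → ℝ} (hX : Measurable X)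
    (h : Integrable (fun ω => |X ω| ^ 3) P) : Integrable X P ∧ Integrable (fun ω => X ω ^ 2) P := by
  have hb : Integrable (fun ω => 1 + |X ω| ^ 3) P := (integrable_const _).add h
  constructor
  · refine hb.mono' hX.aestronglyMeasurable (.of_forall fun ω => ?_)
    rw [Real.norm_eq_abs]
    have := abs_nonneg (X ω)
    rcases le_or_gt |X ω| 1 with h | h
    · linarith [pow_nonneg this 3]
    · nlinarith [mul_pos (sub_pos.2 h) (zero_lt_one.trans h)]
  · refine hb.mono' (hX.pow_const 2).aestronglyMeasurable (.of_forall fun ω => ?_)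
    rw [Real.norm_eq_abs, abs_pow]
    have := abs_nonneg (X ω)
    rcases le_or_gt |X ω| 1 with h | h
    · nlinarith [pow_nonneg this 3]
    · nlinarith [mul_pos (sub_pos.2 h) (pow_pos (zero_lt_one.trans h) 2)]

/-- Both characteristic functions are compared with `1 - t²/2`, the common second-order expansion of
laws with mean `0` and variance `1`. -/
lemma norm_charFun_sub_gaussian_le {X : Ω → ℝ} (hX : Measurable X) (hmean : ∫ ω, X ω ∂P = 0)
    (hvar : ∫ ω, X ω ^ 2 ∂P = 1) {M : ℝ} (hint : Integrable (fun ω => |X ω| ^ 3) P)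
    (hM : ∫ ω, |X ω| ^ 3 ∂P ≤ M) (t : ℝ) :
    ‖∫ ω, Complex.exp ((t * X ω : ℝ) * Complex.I) ∂P - Real.exp (-(t ^ 2 / 2))‖
      ≤ 4 * M * |t| ^ 3 + t ^ 4 := by
  obtain ⟨i1, i2⟩ := integrable_pow_of_integrable_abs_pow_three hX hint
  set T : Ω → ℂ := fun ω => 1 + (t * X ω : ℝ) * Complex.I - ((t * X ω : ℝ) : ℂ) ^ 2 / 2 with hT
  have iT1 : Integrable (fun ω => ((t * X ω : ℝ) : ℂ) * Complex.I) P :=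
    (i1.const_mul t).ofReal.mul_const _
  have iT2 : Integrable (fun ω => ((t * X ω : ℝ) : ℂ) ^ 2 / 2) P := by
    have := ((i2.const_mul (t ^ 2 / 2)).ofReal (𝕜 := ℂ))
    refine this.congr (.of_forall fun ω => ?_)
    simp
    ring
  have iT3 : Integrable (fun ω => 1 + ((t * X ω : ℝ) : ℂ) * Complex.I) P :=
    (integrable_const _).add iT1
  have iT : Integrable T P := iT3.sub iT2
  have hTi : ∫ ω, T ω ∂P = ((1 - t ^ 2 / 2 : ℝ) : ℂ) := by
    simp only [hT]
    rw [integral_sub iT3 iT2, integral_add (integrable_const _) iT1, integral_mul_const,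
      integral_complex_ofReal, integral_const_mul, hmean]
    have : ∀ ω, ((t * X ω : ℝ) : ℂ) ^ 2 / 2 = ((t ^ 2 / 2 * X ω ^ 2 : ℝ) : ℂ) := by
      intro ω; push_cast; ring
    simp_rw [this]
    rw [integral_complex_ofReal, integral_const_mul, hvar]
    simp
  have ie : Integrable (fun ω => Complex.exp ((t * X ω : ℝ) * Complex.I)) P := by
    refine Integrable.of_bound (by fun_prop) 1 (.of_forall fun ω => ?_)
    rw [Complex.norm_exp_ofReal_mul_I]
  have e1 : ‖∫ ω, Complex.exp ((t * X ω : ℝ) * Complex.I) ∂P - ∫ ω, T ω ∂P‖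
      ≤ 4 * M * |t| ^ 3 := by
    rw [← integral_sub ie iT]
    have := norm_integral_le_of_norm_le (μ := P) (hint.const_mul (4 * |t| ^ 3))
      (f := fun ω => Complex.exp ((t * X ω : ℝ) * Complex.I) - T ω) (.of_forall fun ω => by
        refine (norm_cexp_mul_I_sub_taylor_two_le _).trans (le_of_eq ?_)
        rw [abs_mul]; ring)
    refine this.trans ?_
    rw [integral_const_mul]
    nlinarith [mul_le_mul_of_nonneg_left hM (by positivity : 0 ≤ 4 * |t| ^ 3)]
  have e2 : ‖∫ ω, T ω ∂P - Real.exp (-(t ^ 2 / 2))‖ ≤ t ^ 4 := by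
    rw [hTi, ← Complex.ofReal_sub, Complex.norm_real, Real.norm_eq_abs, abs_sub_comm]
    refine (abs_exp_neg_sub_one_sub_le (by positivity)).trans ?_
    nlinarith [sq_nonneg (t ^ 2)]
  calc _ = ‖(∫ ω, Complex.exp ((t * X ω : ℝ) * Complex.I) ∂P - ∫ ω, T ω ∂P)
        + (∫ ω, T ω ∂P - Real.exp (-(t ^ 2 / 2)))‖ := by congr 1; ring
    _ ≤ _ := (norm_add_le _ _).trans (add_le_add e1 e2)

/-- A quantitative central limit theorem for characteristic functions of weighted sums of
independent standardized variables. -/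
lemma norm_integral_cexp_sum_sub_le {n : ℕ} {X : Fin n → Ω → ℝ} (hX : ∀ j, Measurable (X j))
    (hindep : iIndepFun X P) (hmean : ∀ j, ∫ ω, X j ω ∂P = 0) (hvar : ∀ j, ∫ ω, X j ω ^ 2 ∂P = 1)
    {M : ℝ} (hint : ∀ j, Integrable (fun ω => |X j ω| ^ 3) P)
    (hM : ∀ j, ∫ ω, |X j ω| ^ 3 ∂P ≤ M) {a : Fin n → ℝ} {b v : ℝ} (hb : ∀ j, |a j| ≤ b)
    (hM0 : 0 ≤ M) (hv : ∑ j, a j * a j = v) :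
    ‖∫ ω, Complex.exp ((∑ j, a j * X j ω : ℝ) * Complex.I) ∂P - Real.exp (-(v / 2))‖
      ≤ v * (4 * M * b + b ^ 2) := by
  have hY : iIndepFun (fun j ω => a j * X j ω) P :=
    hindep.comp (fun j x => a j * x) (fun j => measurable_const_mul _)
  have hYm : ∀ j, Measurable fun ω => a j * X j ω := fun j => (hX j).const_mul _
  have h1 := hY.charFun_map_fun_sum_eq_prod (fun j => (hYm j).aemeasurable)
  have h2 : ∀ Z : Ω → ℝ, Measurable Z → charFun (P.map Z) 1
      = ∫ ω, Complex.exp ((Z ω : ℝ) * Complex.I) ∂P := by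
    intro Z hZ
    rw [charFun_apply_real, integral_map hZ.aemeasurable (by fun_prop)]
    simp
  have h3 := congrFun h1 1
  rw [Finset.prod_apply, h2 _ (Finset.measurable_fun_sum _ fun j _ => hYm j)] at h3
  rw [h3]
  have h4 : ((Real.exp (-(v / 2)) : ℝ) : ℂ) = ∏ j, ((Real.exp (-(a j ^ 2 / 2)) : ℝ) : ℂ) := by
    rw [← Complex.ofReal_prod, ← Real.exp_sum, ← hv, Finset.sum_div, ← Finset.sum_neg_distrib]
    simp_rw [sq]
  rw [h4]
  refine (norm_prod_sub_prod_le _ _ _ ?_ ?_).trans ?_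
  · intro j _
    have := Measure.isProbabilityMeasure_map (μ := P) (hYm j).aemeasurable
    exact norm_charFun_le_one _
  · intro j _
    rw [Complex.norm_real, Real.norm_eq_abs, abs_of_pos (Real.exp_pos _)]
    exact Real.exp_le_one_iff.2 (by have := sq_nonneg (a j); linarith)
  · rw [← hv, Finset.sum_mul]
    refine Finset.sum_le_sum fun j _ => ?_
    rw [h2 _ (hYm j)]
    refine (norm_charFun_sub_gaussian_le (hX j) (hmean j) (hvar j) (hint j) (hM j) (a j)).trans ?_
    -- One factor `a_j²` is kept to sum to `v`; the remaining powers are bounded by `b`.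
    have e1 : |a j| ^ 3 = (a j * a j) * |a j| := by
      rw [← sq, ← sq_abs]; ring
    have e2 : a j ^ 4 = (a j * a j) * |a j| ^ 2 := by rw [sq_abs]; ring
    rw [e1, e2]
    have e3 : 0 ≤ a j * a j := mul_self_nonneg _
    have e4 : |a j| ^ 2 ≤ b ^ 2 := pow_le_pow_left₀ (abs_nonneg _) (hb j) 2
    have e5 : M * |a j| ≤ M * b := mul_le_mul_of_nonneg_left (hb j) hM0
    nlinarith [mul_le_mul_of_nonneg_left e4 e3, mul_le_mul_of_nonneg_left e5 e3]

/-- `cos(L + α)` is the real part of `e^{iα} e^{iL}`, and since all forms have the same norm, every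
term of the average has the same Gaussian approximation. -/
lemma abs_integral_cosMean_sub_le {κ : Type*} [DecidableEq κ] {s : Finset κ} (hs : s.Nonempty)
    {n : ℕ} {X : Fin n → Ω → ℝ} (hX : ∀ j, Measurable (X j))
    (hindep : iIndepFun X P) (hmean : ∀ j, ∫ ω, X j ω ∂P = 0) (hvar : ∀ j, ∫ ω, X j ω ^ 2 ∂P = 1)
    {M : ℝ} (hint : ∀ j, Integrable (fun ω => |X j ω| ^ 3) P)
    (hM : ∀ j, ∫ ω, |X j ω| ^ 3 ∂P ≤ M) {a : Fin n → κ → ℝ} {b v : ℝ}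
    (hb : ∀ j, ∀ k ∈ s, |a j k| ≤ b) (hb0 : 0 ≤ b) (hM0 : 0 ≤ M) (hv0 : 0 ≤ v)
    (hv : ∀ k ∈ s, ∑ j, a j k * a j k = v) (α : ℝ) :
    |∫ ω, cosMean s a α (fun j => X j ω) ∂P - Real.cos α * Real.exp (-(v / 2))|
      ≤ v * (4 * M * b + b ^ 2) := by
  have hk : ∀ k ∈ s, |∫ ω, Real.cos (∑ j, a j k * X j ω + α) ∂P
      - Real.cos α * Real.exp (-(v / 2))| ≤ v * (4 * M * b + b ^ 2) := by
    intro k hk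
    have h1 := norm_integral_cexp_sum_sub_le hX hindep hmean hvar hint hM
      (fun j => hb j k hk) hM0 (hv k hk)
    set E := ∫ ω, Complex.exp ((∑ j, a j k * X j ω : ℝ) * Complex.I) ∂P with hE
    have ie : Integrable (fun ω => Complex.exp ((∑ j, a j k * X j ω : ℝ) * Complex.I)) P := by
      refine Integrable.of_bound (by fun_prop) 1 (.of_forall fun ω => ?_)
      rw [Complex.norm_exp_ofReal_mul_I]
    have h2 : ∫ ω, Real.cos (∑ j, a j k * X j ω + α) ∂P
        = (Complex.exp (α * Complex.I) * E).re := by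
      rw [hE, ← integral_const_mul, ← RCLike.re_eq_complex_re, ← integral_re (ie.const_mul _)]
      refine integral_congr_ae (.of_forall fun ω => ?_)
      simp only [RCLike.re_eq_complex_re]
      rw [← Complex.exp_add, ← add_mul, ← Complex.ofReal_add, Complex.exp_ofReal_mul_I_re, add_comm]
    have h3 : Real.cos α * Real.exp (-(v / 2))
        = (Complex.exp (α * Complex.I) * (Real.exp (-(v / 2)) : ℝ)).re := by
      rw [Complex.re_mul_ofReal, Complex.exp_ofReal_mul_I_re]
    rw [h2, h3, ← Complex.sub_re, ← mul_sub]
    refine (Complex.abs_re_le_norm _).trans ?_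
    rw [norm_mul, Complex.norm_exp_ofReal_mul_I, one_mul]
    exact h1
  have hc : (0 : ℝ) < s.card := by exact_mod_cast hs.card_pos
  have h4 : ∫ ω, cosMean s a α (fun j => X j ω) ∂P - Real.cos α * Real.exp (-(v / 2))
      = (1 / (s.card : ℝ)) * ∑ k ∈ s, (∫ ω, Real.cos (∑ j, a j k * X j ω + α) ∂P
      - Real.cos α * Real.exp (-(v / 2))) := by
    simp only [cosMean]
    rw [integral_const_mul, integral_finsetSum, Finset.sum_sub_distrib, Finset.sum_const,
      nsmul_eq_mul]
    · field_simp
    · intro k _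
      exact integrable_of_measurable_bounded (B := 1) (by fun_prop) fun ω => Real.abs_cos_le_one _
  rw [h4]
  exact abs_mean_le (by positivity) hk

end Clt

/-! ### One-sided law of large numbers for tails of squares -/

lemma tsum_ofReal_geometric_ne_top (C : ℝ) :
    ∑' p : ℕ, ENNReal.ofReal (C * (1 / 2) ^ p) ≠ ⊤ :=
  ((summable_geometric_two.mul_left C)).tsum_ofReal_ne_top

/-- `x ^ 2` where `K < |x| ≤ T`, and zero elsewhere. -/
noncomputable def sqBand (K T x : ℝ) : ℝ := if K < |x| ∧ |x| ≤ T then x ^ 2 else 0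

lemma measurable_sqBand (K T : ℝ) : Measurable (sqBand K T) := by
  unfold sqBand
  refine Measurable.ite ?_ (by fun_prop) measurable_const
  exact (measurableSet_lt measurable_const measurable_id.abs).inter
    (measurableSet_le measurable_id.abs measurable_const)

/-- `x ^ 2` where `K < |x|`, and zero elsewhere. -/
noncomputable def sqTail (K x : ℝ) : ℝ := if K < |x| then x ^ 2 else 0

lemma measurable_sqTail (K : ℝ) : Measurable (sqTail K) := by
  unfold sqTail
  exact Measurable.ite (measurableSet_lt measurable_const measurable_id.abs) (by fun_prop)
    measurable_const

lemma sqTail_nonneg (K x : ℝ) : 0 ≤ sqTail K x := by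
  unfold sqTail; split_ifs <;> positivity

lemma sqTail_le_sq (K x : ℝ) : sqTail K x ≤ x ^ 2 := by
  unfold sqTail; split_ifs <;> [exact le_rfl; positivity]

lemma sqBand_le_sqTail (K T x : ℝ) : sqBand K T x ≤ sqTail K x := by
  unfold sqBand sqTail
  by_cases h1 : K < |x| <;> by_cases h2 : |x| ≤ T <;> simp [h1, h2, sq_nonneg]

lemma sqBand_eq_sqTail {K T x : ℝ} (h : |x| ≤ T) : sqBand K T x = sqTail K x := by
  simp [sqBand, sqTail, h]

/-- No fourth moment is assumed, so the upper cut at `T` trades one power of `|x|` for `T`. -/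
lemma sqBand_sq_le {K T x : ℝ} (hT : 0 ≤ T) : sqBand K T x ^ 2 ≤ T * |x| ^ 3 := by
  unfold sqBand
  split_ifs with h
  · have : (x ^ 2) ^ 2 = |x| * |x| ^ 3 := by
      rw [← sq_abs x]; ring
    rw [this]
    exact mul_le_mul_of_nonneg_right h.2 (by positivity)
  · have : 0 ≤ T * |x| ^ 3 := by positivity
    simpa using this

section Lln

variable {Ω : Type*} [MeasurableSpace Ω] {P : Measure Ω} [IsProbabilityMeasure P]

lemma integrable_sqTail {X : Ω → ℝ} (hX : Measurable X)
    (hint : Integrable (fun ω => |X ω| ^ 3) P) (K : ℝ) :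
    Integrable (fun ω => sqTail K (X ω)) P := by
  refine (integrable_pow_of_integrable_abs_pow_three hX hint).2.mono'
    ((measurable_sqTail K).comp hX).aestronglyMeasurable (.of_forall fun ω => ?_)
  rw [Real.norm_eq_abs, abs_of_nonneg (sqTail_nonneg _ _)]
  exact sqTail_le_sq _ _

lemma measure_exists_lt_abs_le {X : ℕ → Ω → ℝ} {M : ℝ}
    (hint : ∀ j, Integrable (fun ω => |X j ω| ^ 3) P)
    (hM : ∀ j, ∫ ω, |X j ω| ^ 3 ∂P ≤ M) {T : ℝ} (hT : 0 < T) (N : ℕ) :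
    P {ω | ∃ j < N, T < |X j ω|} ≤ ENNReal.ofReal (N * (M / T ^ 3)) := by
  have h1 : {ω | ∃ j < N, T < |X j ω|} ⊆ ⋃ j ∈ Finset.range N, {ω | T ^ 3 ≤ |X j ω| ^ 3} := by
    rintro ω ⟨j, hj, h⟩
    simp only [Set.mem_iUnion, Finset.mem_range]
    exact ⟨j, hj, pow_le_pow_left₀ hT.le h.le 3⟩
  have h2 : ∀ j, P {ω | T ^ 3 ≤ |X j ω| ^ 3} ≤ ENNReal.ofReal (M / T ^ 3) := by
    intro j
    have h3 := mul_meas_ge_le_integral_of_nonneg (μ := P) (f := fun ω => |X j ω| ^ 3)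
      (.of_forall fun ω => by positivity) (hint j) (T ^ 3)
    have hT3 : 0 < T ^ 3 := by positivity
    rw [← ofReal_measureReal]
    refine ENNReal.ofReal_le_ofReal ?_
    rw [le_div_iff₀ hT3, mul_comm]
    exact h3.trans (hM j)
  have hM0 : 0 ≤ M := (integral_nonneg fun ω => by positivity).trans (hM 0)
  calc P _ ≤ ∑ j ∈ Finset.range N, P {ω | T ^ 3 ≤ |X j ω| ^ 3} :=
        (measure_mono h1).trans (measure_biUnion_finset_le _ _)
    _ ≤ ∑ j ∈ Finset.range N, ENNReal.ofReal (M / T ^ 3) := Finset.sum_le_sum fun j _ => h2 j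
    _ = _ := by
      rw [Finset.sum_const, Finset.card_range, nsmul_eq_mul, ENNReal.ofReal_mul (by positivity)]
      simp

/-- Chebyshev: the sum has mean at most `N m` and, by independence, variance at most `N T M`. -/
lemma measure_sum_sqBand_ge_le {X : ℕ → Ω → ℝ} (hX : ∀ j, Measurable (X j))
    (hindep : iIndepFun X P) {M : ℝ} (hint : ∀ j, Integrable (fun ω => |X j ω| ^ 3) P)
    (hM : ∀ j, ∫ ω, |X j ω| ^ 3 ∂P ≤ M) {K m : ℝ} (hm : 0 < m)
    (hK : ∀ j, ∫ ω, sqTail K (X j ω) ∂P ≤ m) {T : ℝ} (hT : 0 < T) {N : ℕ} (hN : 0 < N) :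
    P {ω | 2 * m * N < ∑ j ∈ Finset.range N, sqBand K T (X j ω)}
      ≤ ENNReal.ofReal (T * M / (N * m ^ 2)) := by
  have hN' : (0 : ℝ) < N := by exact_mod_cast hN
  set V : ℕ → Ω → ℝ := fun j ω => sqBand K T (X j ω) with hV
  have hVm : ∀ j, Measurable (V j) := fun j => (measurable_sqBand K T).comp (hX j)
  have hVB : ∀ j ω, |V j ω| ≤ T ^ 2 := by
    intro j ω
    simp only [hV, sqBand]
    split_ifs with h
    · rw [abs_pow]; exact pow_le_pow_left₀ (abs_nonneg _) h.2 2
    · simpa using sq_nonneg T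
  have hVL : ∀ j, MemLp (V j) 2 P := fun j =>
    MemLp.of_bound (hVm j).aestronglyMeasurable (T ^ 2) (.of_forall (hVB j))
  have hVi : iIndepFun V P := hindep.comp (fun _ => sqBand K T) fun _ => measurable_sqBand K T
  have hvar1 : ∀ j, variance (V j) P ≤ T * M := by
    intro j
    refine (variance_le_expectation_sq (hVm j).aestronglyMeasurable).trans ?_
    calc ∫ ω, (V j ^ 2) ω ∂P ≤ ∫ ω, T * |X j ω| ^ 3 ∂P := by
          refine integral_mono_of_nonneg (.of_forall fun ω => sq_nonneg _)
            ((hint j).const_mul T) (.of_forall fun ω => sqBand_sq_le hT.le)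
      _ ≤ T * M := by
          rw [integral_const_mul]
          exact mul_le_mul_of_nonneg_left (hM j) hT.le
  have hvarS : variance (∑ j ∈ Finset.range N, V j) P ≤ N * (T * M) := by
    rw [IndepFun.variance_sum (fun j _ => hVL j) (fun i _ j _ hij => hVi.indepFun hij)]
    refine (Finset.sum_le_sum fun j _ => hvar1 j).trans ?_
    simp
  have hSL : MemLp (∑ j ∈ Finset.range N, V j) 2 P := memLp_finsetSum' _ fun j _ => hVL j
  have hmean : ∫ ω, (∑ j ∈ Finset.range N, V j) ω ∂P ≤ N * m := by
    simp only [Finset.sum_apply]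
    rw [integral_finsetSum _ fun j _ => (hVL j).integrable one_le_two]
    have hsum : ∑ _j ∈ Finset.range N, m = N * m := by simp
    rw [← hsum]
    refine Finset.sum_le_sum fun j _ => ?_
    refine le_trans ?_ (hK j)
    exact integral_mono ((hVL j).integrable one_le_two) (integrable_sqTail (hX j) (hint j) K)
      fun ω => sqBand_le_sqTail _ _ _
  have hc : 0 < N * m := by positivity
  refine le_trans (measure_mono ?_) ((meas_ge_le_variance_div_sq hSL hc).trans
    (ENNReal.ofReal_le_ofReal ?_))
  · intro ω hω
    simp only [Set.mem_ofPred_eq] at hω ⊢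
    refine le_trans ?_ (le_abs_self _)
    rw [Finset.sum_apply]
    linarith
  · rw [div_le_div_iff₀ (by positivity) (by positivity)]
    calc _ ≤ (N * (T * M)) * (N * m ^ 2) := by gcongr
      _ = _ := by ring

/-- A one-sided law of large numbers for the tails of the squares. -/
theorem ae_eventually_sum_sqTail_le {X : ℕ → Ω → ℝ} (hX : ∀ j, Measurable (X j))
    (hindep : iIndepFun X P) {M : ℝ} (hint : ∀ j, Integrable (fun ω => |X j ω| ^ 3) P)
    (hM : ∀ j, ∫ ω, |X j ω| ^ 3 ∂P ≤ M) {K m : ℝ} (hm : 0 < m)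
    (hK : ∀ j, ∫ ω, sqTail K (X j ω) ∂P ≤ m) :
    ∀ᵐ ω ∂P, ∀ᶠ n : ℕ in atTop, ∑ j ∈ Finset.range n, sqTail K (X j ω) ≤ 8 * m * n := by
  -- With `N = 4^p` and `T = 2^p = √N`, both error terms `N M / T³` and `T M / (N m²)` are of order
  -- `2^{-p}`, hence summable.
  set A : ℕ → Set Ω := fun p => {ω | ∃ j < 4 ^ p, (2 : ℝ) ^ p < |X j ω|} with hA
  set B : ℕ → Set Ω := fun p => {ω | 2 * m * (4 ^ p : ℕ) <
    ∑ j ∈ Finset.range (4 ^ p), sqBand K (2 ^ p) (X j ω)} with hB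
  have h84 : ∀ p : ℕ, (4 : ℝ) ^ p = 2 ^ p * 2 ^ p := fun p => by rw [← mul_pow]; norm_num
  have hPA : ∀ p, P (A p) ≤ ENNReal.ofReal (M * (1 / 2) ^ p) := by
    intro p
    refine (measure_exists_lt_abs_le hint hM (by positivity) _).trans (le_of_eq ?_)
    congr 1
    push_cast
    rw [h84, div_pow, one_pow]
    field_simp
  have hPB : ∀ p, P (B p) ≤ ENNReal.ofReal ((M / m ^ 2) * (1 / 2) ^ p) := by
    intro p
    refine (measure_sum_sqBand_ge_le hX hindep hint hM hm hK (by positivity)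
      (by positivity)).trans (le_of_eq ?_)
    congr 1
    push_cast
    rw [h84, div_pow, one_pow]
    field_simp
  have sA : ∑' p, P (A p) ≠ ⊤ :=
    ne_top_of_le_ne_top (tsum_ofReal_geometric_ne_top M) (ENNReal.tsum_le_tsum hPA)
  have sB : ∑' p, P (B p) ≠ ⊤ :=
    ne_top_of_le_ne_top (tsum_ofReal_geometric_ne_top (M / m ^ 2)) (ENNReal.tsum_le_tsum hPB)
  filter_upwards [ae_eventually_notMem sA, ae_eventually_notMem sB] with ω h1 h2
  obtain ⟨p₀, hp⟩ := eventually_atTop.1 (h1.and h2)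
  filter_upwards [eventually_ge_atTop (4 ^ p₀)] with n hn
  have hn0 : n ≠ 0 := by have : 0 < 4 ^ p₀ := by positivity
                         omega
  -- The sums increase with `n`, so block ends suffice; moving up to `4^(p+1) ≤ 4n` turns the factor
  -- `2` into `8`.
  set p := Nat.log 4 n with hpdef
  have hp0 : p₀ ≤ p := Nat.le_log_of_pow_le (by norm_num) hn
  have hlow : 4 ^ p ≤ n := Nat.pow_log_le_self 4 hn0
  have hup : n < 4 ^ (p + 1) := Nat.lt_pow_succ_log_self (by norm_num) n
  obtain ⟨hA', hB'⟩ := hp (p + 1) (by omega)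
  simp only [hA, hB, Set.mem_ofPred_eq, not_exists, not_and, not_lt] at hA' hB'
  calc ∑ j ∈ Finset.range n, sqTail K (X j ω)
      ≤ ∑ j ∈ Finset.range (4 ^ (p + 1)), sqTail K (X j ω) :=
        Finset.sum_le_sum_of_subset_of_nonneg (Finset.range_mono hup.le)
          fun j _ _ => sqTail_nonneg _ _
    _ = ∑ j ∈ Finset.range (4 ^ (p + 1)), sqBand K (2 ^ (p + 1)) (X j ω) :=
        Finset.sum_congr rfl fun j hj => (sqBand_eq_sqTail (hA' j (Finset.mem_range.1 hj))).symm
    _ ≤ 2 * m * (4 ^ (p + 1) : ℕ) := hB'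
    _ = 8 * m * (4 ^ p : ℕ) := by push_cast; ring
    _ ≤ 8 * m * n := by
        have : ((4 ^ p : ℕ) : ℝ) ≤ n := by exact_mod_cast hlow
        gcongr

end Lln

/-! ### Truncation, concentration and almost sure convergence -/

/-- `x` where `|x| ≤ K`, and zero elsewhere. -/
noncomputable def cutoff (K x : ℝ) : ℝ := if |x| ≤ K then x else 0

lemma measurable_cutoff (K : ℝ) : Measurable (cutoff K) := by
  unfold cutoff
  exact Measurable.ite (measurableSet_le measurable_id.abs measurable_const) measurable_id
    measurable_const

lemma abs_cutoff_le {K : ℝ} (hK : 0 ≤ K) (x : ℝ) : |cutoff K x| ≤ K := by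
  unfold cutoff; split_ifs with h <;> simp [h, hK]

lemma cutoff_zero (K : ℝ) : cutoff K 0 = 0 := by
  unfold cutoff; split_ifs <;> rfl

lemma sub_cutoff_sq (K x : ℝ) : (x - cutoff K x) ^ 2 = sqTail K x := by
  unfold cutoff sqTail
  by_cases h : |x| ≤ K
  · simp [h, not_lt.2 h]
  · simp [h, not_le.1 h]

lemma integral_sqTail_le {Ω : Type*} [MeasurableSpace Ω] {P : Measure Ω} {X : Ω → ℝ}
    {M : ℝ} (hint : Integrable (fun ω => |X ω| ^ 3) P)
    (hM : ∫ ω, |X ω| ^ 3 ∂P ≤ M) {K : ℝ} (hK : 0 < K) : ∫ ω, sqTail K (X ω) ∂P ≤ M / K := by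
  have h : ∀ x : ℝ, sqTail K x ≤ K⁻¹ * |x| ^ 3 := by
    intro x
    unfold sqTail
    split_ifs with h
    · rw [inv_mul_eq_div, le_div_iff₀ hK, ← sq_abs]
      nlinarith [mul_le_mul_of_nonneg_left h.le (sq_nonneg |x|)]
    · positivity
  calc ∫ ω, sqTail K (X ω) ∂P ≤ ∫ ω, K⁻¹ * |X ω| ^ 3 ∂P :=
        integral_mono_of_nonneg (.of_forall fun ω => sqTail_nonneg _ _) (hint.const_mul _)
          (.of_forall fun ω => h _)
    _ = K⁻¹ * ∫ ω, |X ω| ^ 3 ∂P := integral_const_mul _ _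
    _ ≤ M / K := by rw [inv_mul_eq_div]; gcongr

section Concentration

variable {Ω : Type*} [MeasurableSpace Ω] {P : Measure Ω} [IsProbabilityMeasure P]
  {κ : Type*} [DecidableEq κ]

/-- Fourth-moment deviation bound for averages of cosines of linear forms in truncated
independent variables. -/
lemma measure_abs_cosMean_cutoff_sub_ge_le {s : Finset κ} {n : ℕ} {X : Fin n → Ω → ℝ}
    (hX : ∀ j, Measurable (X j)) (hindep : iIndepFun X P) {a : Fin n → κ → ℝ} {v b : ℝ}
    (hv : 0 ≤ v) (h : ∀ k ∈ s, ∀ l ∈ s, ∑ j, a j k * a j l = if k = l then v else 0)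
    (hb : ∀ j, ∀ k ∈ s, |a j k| ≤ b) (α : ℝ) {K : ℝ} (hK : 0 ≤ K) {δ : ℝ} (hδ : 0 < δ) :
    P {ω | δ ≤ |cosMean s a α (fun j => cutoff K (X j ω))
        - ∫ ω', cosMean s a α (fun j => cutoff K (X j ω')) ∂P|}
      ≤ ENNReal.ofReal
        (11 * (2 * K ^ 2 * v / s.card + 18 * n * b ^ 4 * K ^ 4) ^ 2 / δ ^ 4) := by
  set D := 2 * K ^ 2 * v / s.card + 18 * n * b ^ 4 * K ^ 4 with hD
  set F : (Fin n → ℝ) → ℝ := fun x => cosMean s a α (fun j => cutoff K (x j)) with hF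
  have hFm : Measurable F := by
    refine (measurable_cosMean α).comp (measurable_pi_lambda _ fun j => ?_)
    exact (measurable_cutoff K).comp (measurable_pi_apply j)
  have hFB : ∀ x, |F x| ≤ 1 := fun x => abs_cosMean_le _ _
  have hFD : ∀ x, ∑ j, (F x - F (Function.update x j 0)) ^ 2 ≤ D := by
    intro x
    have h1 := sum_sq_cosMean_update_le hv h hb α (K := K) (x := fun j => cutoff K (x j))
      (fun j => abs_cutoff_le hK _)
    rw [Fintype.card_fin] at h1
    refine le_trans (le_of_eq ?_) h1
    refine Finset.sum_congr rfl fun j _ => ?_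
    -- Truncation fixes `0`, so it commutes with setting a coordinate to `0`.
    have : (fun i => cutoff K (Function.update x j 0 i))
        = Function.update (fun i => cutoff K (x i)) j 0 := by
      ext i
      rcases eq_or_ne i j with rfl | hij
      · simp [cutoff_zero]
      · simp [hij]
    simp only [hF, this]
  have hXm : Measurable fun ω j => X j ω := measurable_pi_lambda _ hX
  have hmap : P.map (fun ω j => X j ω) = Measure.pi fun j => P.map (X j) :=
    (iIndepFun_iff_map_fun_eq_pi_map fun j => (hX j).aemeasurable).1 hindep
  have : ∀ j, IsProbabilityMeasure (P.map (X j)) := fun j =>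
    Measure.isProbabilityMeasure_map (hX j).aemeasurable
  have h4 := fourth_central_moment_le (fun j => P.map (X j)) hFm hFB hFD
  rw [← hmap, integral_map hXm.aemeasurable
    ((hFm.sub_const _).pow_const 4).aestronglyMeasurable,
    integral_map hXm.aemeasurable hFm.aestronglyMeasurable] at h4
  set c := ∫ ω', F (fun j => X j ω') ∂P with hc
  have hcB : |c| ≤ 1 := by
    have := norm_integral_le_of_norm_le_const (μ := P) (f := fun ω => F (fun j => X j ω)) (C := 1)
      (.of_forall fun ω => hFB _)
    simpa using this
  have hi : Integrable (fun ω => (F (fun j => X j ω) - c) ^ 4) P := by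
    refine integrable_of_measurable_bounded (B := 2 ^ 4)
      (((hFm.comp hXm).sub_const c).pow_const 4) fun ω => ?_
    rw [abs_pow]
    refine pow_le_pow_left₀ (abs_nonneg _) ((abs_sub _ _).trans ?_) 4
    linarith [hFB (fun j => X j ω)]
  have h5 := mul_meas_ge_le_integral_of_nonneg (μ := P)
    (.of_forall fun ω => by positivity) hi (δ ^ 4)
  rw [← ofReal_measureReal]
  refine ENNReal.ofReal_le_ofReal ?_
  rw [le_div_iff₀ (by positivity), mul_comm]
  refine le_trans ?_ (h5.trans h4)
  refine mul_le_mul_of_nonneg_left (measureReal_mono fun ω hω => ?_) (by positivity)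
  simp only [Set.mem_ofPred_eq] at hω ⊢
  calc δ ^ 4 ≤ |F (fun j => X j ω) - c| ^ 4 := pow_le_pow_left₀ hδ.le hω 4
    _ = _ := by rw [← abs_pow, abs_of_nonneg (by positivity)]

/-- Almost sure convergence of averages of cosines along a triangular array of orthogonal
families of linear forms. -/
theorem ae_tendsto_cosMean {X : ℕ → Ω → ℝ} (hX : ∀ j, Measurable (X j)) (hindep : iIndepFun X P)
    (hmean : ∀ j, ∫ ω, X j ω ∂P = 0) (hvar : ∀ j, ∫ ω, X j ω ^ 2 ∂P = 1)
    {M : ℝ} (hint : ∀ j, Integrable (fun ω => |X j ω| ^ 3) P)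
    (hM : ∀ j, ∫ ω, |X j ω| ^ 3 ∂P ≤ M) {s : ℕ → Finset κ} (hs : ∀ n, 3 ≤ n → n ≤ 4 * (s n).card)
    {a : (n : ℕ) → Fin n → κ → ℝ} {v B : ℝ} (hv : 0 ≤ v) (hB : 0 ≤ B)
    (h : ∀ n, ∀ k ∈ s n, ∀ l ∈ s n, ∑ j, a n j k * a n j l = if k = l then v else 0)
    (hb : ∀ n j, ∀ k ∈ s n, |a n j k| ≤ B / √n) (α : ℝ) :
    ∀ᵐ ω ∂P, Tendsto (fun n => cosMean (s n) (a n) α (fun j : Fin n => X j ω)) atTop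
      (𝓝 (Real.cos α * Real.exp (-(v / 2)))) := by
  have hM0 : 0 ≤ M := (integral_nonneg fun ω => by positivity).trans (hM 0)
  have hXn : ∀ n, iIndepFun (fun j : Fin n => X j) P := fun n =>
    hindep.precomp Fin.val_injective
  have hcard : ∀ n : ℕ, 3 ≤ n → (0 : ℝ) < (s n).card ∧ v / (s n).card ≤ 4 * v / n := by
    intro n hn
    have h1 := hs n hn
    have h2 : 0 < (s n).card := by omega
    have h3 : (n : ℝ) ≤ 4 * (s n).card := by exact_mod_cast h1
    have h4 : (0 : ℝ) < (s n).card := by exact_mod_cast h2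
    have h5 : (0 : ℝ) < n := by exact_mod_cast (by omega : 0 < n)
    refine ⟨h4, ?_⟩
    rw [div_le_div_iff₀ h4 h5]
    nlinarith
  set G : ℕ → Ω → ℝ := fun n ω => cosMean (s n) (a n) α (fun j : Fin n => X j ω) with hG
  set Y : ℝ → ℕ → Ω → ℝ := fun K n ω =>
    cosMean (s n) (a n) α (fun j : Fin n => cutoff K (X j ω)) with hY
  have hGm : ∀ n, Measurable (G n) := fun n =>
    (measurable_cosMean α).comp (measurable_pi_lambda _ fun j => hX j)
  have hYm : ∀ K n, Measurable (Y K n) := fun K n =>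
    (measurable_cosMean α).comp
      (measurable_pi_lambda _ fun j => (measurable_cutoff K).comp (hX j))
  have hGY : ∀ K n, 3 ≤ n → ∀ ω, (G n ω - Y K n ω) ^ 2
      ≤ 4 * v / n * ∑ j ∈ Finset.range n, sqTail K (X j ω) := by
    intro K n hn ω
    refine (sq_cosMean_sub_le hv (h n) α _ _).trans ?_
    simp only [sub_cutoff_sq]
    rw [Finset.sum_range]
    exact mul_le_mul_of_nonneg_right (hcard n hn).2
      (Finset.sum_nonneg fun j _ => sqTail_nonneg _ _)
  -- concentration of the truncated averages
  have hconc : ∀ K : ℝ, 0 ≤ K → ∀ δ : ℝ, 0 < δ → ∀ᵐ ω ∂P, ∀ᶠ n in atTop,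
      |Y K n ω - ∫ ω', Y K n ω' ∂P| < δ := by
    intro K hK δ hδ
    set C := 8 * K ^ 2 * v + 18 * B ^ 4 * K ^ 4 with hC
    have hC0 : 0 ≤ C := by positivity
    set A : ℕ → Set Ω := fun n => {ω | δ ≤ |Y K n ω - ∫ ω', Y K n ω' ∂P|} with hA
    -- The sum of squared increments is at most `C / N`, so the fourth-moment bound is `O(N⁻²)`. The
    -- shift by `3` matches the range where `hs` bounds the cardinality from below.
    have hPA : ∀ n : ℕ, P (A (n + 3))
        ≤ ENNReal.ofReal (11 * C ^ 2 / δ ^ 4 * (1 / ((n + 3 : ℕ) : ℝ) ^ 2)) := by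
      intro n
      set N := n + 3 with hN
      have hN3 : 3 ≤ N := by omega
      have hN0 : (0 : ℝ) < N := by exact_mod_cast (by omega : 0 < N)
      refine (measure_abs_cosMean_cutoff_sub_ge_le (fun j : Fin N => hX j) (hXn N) hv (h N)
        (hb N) α hK hδ).trans (ENNReal.ofReal_le_ofReal ?_)
      have e1 : 2 * K ^ 2 * v / (s N).card + 18 * N * (B / √N) ^ 4 * K ^ 4 ≤ C / N := by
        have e2 : 2 * K ^ 2 * v / (s N).card ≤ 8 * K ^ 2 * v / N := by
          calc _ = 2 * K ^ 2 * (v / (s N).card) := by ring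
            _ ≤ 2 * K ^ 2 * (4 * v / N) := 
              mul_le_mul_of_nonneg_left (hcard N hN3).2 (by positivity)
            _ = _ := by ring
        have e3 : (B / √N) ^ 4 = B ^ 4 / N ^ 2 := by
          rw [div_pow]
          congr 1
          rw [show (4 : ℕ) = 2 * 2 from rfl, pow_mul, Real.sq_sqrt hN0.le]
        rw [e3]
        have e4 : 18 * N * (B ^ 4 / N ^ 2) * K ^ 4 = 18 * B ^ 4 * K ^ 4 / N := by
          field_simp
        rw [e4, hC, add_div]
        linarith
      have e5 : 0 ≤ 2 * K ^ 2 * v / (s N).card + 18 * N * (B / √N) ^ 4 * K ^ 4 := by positivity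
      calc _ ≤ 11 * (C / N) ^ 2 / δ ^ 4 := by gcongr
        _ = _ := by field_simp
    have hsum : Summable fun n : ℕ => 11 * C ^ 2 / δ ^ 4 * (1 / ((n + 3 : ℕ) : ℝ) ^ 2) :=
      (((summable_nat_add_iff 3).2 (Real.summable_one_div_nat_pow.2 one_lt_two))).mul_left _
    have hfin : ∑' n, P (A (n + 3)) ≠ ⊤ :=
      ne_top_of_le_ne_top hsum.tsum_ofReal_ne_top (ENNReal.tsum_le_tsum hPA)
    filter_upwards [ae_eventually_notMem hfin] with ω hω
    obtain ⟨n₀, hn₀⟩ := eventually_atTop.1 hω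
    filter_upwards [eventually_ge_atTop (n₀ + 3)] with n hn
    have := hn₀ (n - 3) (by omega)
    rw [Nat.sub_add_cancel (by omega)] at this
    simpa [hA] using this
  -- the truncation error
  have htail : ∀ K : ℝ, 0 < K → ∀ᵐ ω ∂P, ∀ᶠ n : ℕ in atTop,
      (G n ω - Y K n ω) ^ 2 ≤ 32 * v * ((M + 1) / K) := by
    intro K hK
    -- `M + 1` rather than `M`, since the law of large numbers needs a strictly positive bound.
    have hm : 0 < (M + 1) / K := by positivity
    filter_upwards [ae_eventually_sum_sqTail_le hX hindep hint hM hm (fun j =>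
      (integral_sqTail_le (hint j) (hM j) hK).trans (by gcongr; linarith))] with ω hω
    filter_upwards [hω, eventually_ge_atTop 3] with n hn hn3
    have hn0 : (0 : ℝ) < n := by exact_mod_cast (by omega : 0 < n)
    calc _ ≤ 4 * v / n * (8 * ((M + 1) / K) * n) := by
          refine (hGY K n hn3 ω).trans ?_
          gcongr
      _ = _ := by field_simp; ring
  have hE : ∀ K : ℝ, 0 < K → ∀ n, 3 ≤ n →
      (∫ ω, G n ω ∂P - ∫ ω, Y K n ω ∂P) ^ 2 ≤ 32 * v * ((M + 1) / K) := by
    intro K hK n hn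
    have hn0 : (0 : ℝ) < n := by exact_mod_cast (by omega : 0 < n)
    have iG : Integrable (G n) P := integrable_of_measurable_bounded (hGm n) fun ω =>
      abs_cosMean_le _ _
    have iY : Integrable (Y K n) P := integrable_of_measurable_bounded (hYm K n) fun ω =>
      abs_cosMean_le _ _
    have iT : ∀ j, Integrable (fun ω => sqTail K (X j ω)) P := fun j =>
      integrable_sqTail (hX j) (hint j) K
    rw [← integral_sub iG iY]
    refine (sq_integral_le_integral_sq (B := 2) ((hGm n).sub (hYm K n)) fun ω => ?_).trans ?_
    · have h1 : |G n ω| ≤ 1 := abs_cosMean_le _ _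
      have h2 : |Y K n ω| ≤ 1 := abs_cosMean_le _ _
      exact (abs_sub _ _).trans (by linarith)
    · calc ∫ ω, (G n ω - Y K n ω) ^ 2 ∂P
          ≤ ∫ ω, 4 * v / n * ∑ j ∈ Finset.range n, sqTail K (X j ω) ∂P :=
            integral_mono_of_nonneg (.of_forall fun ω => sq_nonneg _)
              ((integrable_finsetSum _ fun j _ => iT j).const_mul _)
              (.of_forall fun ω => hGY K n hn ω)
        _ = 4 * v / n * ∑ j ∈ Finset.range n, ∫ ω, sqTail K (X j ω) ∂P := by
            rw [integral_const_mul, integral_finsetSum _ fun j _ => iT j]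
        _ ≤ 4 * v / n * ∑ j ∈ Finset.range n, (M + 1) / K := by
            gcongr with j _
            exact (integral_sqTail_le (hint j) (hM j) hK).trans (by gcongr; linarith)
        _ = 4 * v * ((M + 1) / K) := by
            rw [Finset.sum_const, Finset.card_range, nsmul_eq_mul]
            field_simp
        _ ≤ _ := by
            have : 0 ≤ v * ((M + 1) / K) := by positivity
            nlinarith
  have hclt : Tendsto (fun n => ∫ ω, G n ω ∂P) atTop (𝓝 (Real.cos α * Real.exp (-(v / 2)))) := by
    have hb0 : Tendsto (fun n : ℕ => B / √(n : ℝ)) atTop (𝓝 0) :=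
      tendsto_const_nhds.div_atTop (Real.tendsto_sqrt_atTop.comp tendsto_natCast_atTop_atTop)
    have hbd : Tendsto (fun n : ℕ => v * (4 * M * (B / √(n : ℝ)) + (B / √(n : ℝ)) ^ 2)) atTop
        (𝓝 0) := by
      have := ((hb0.const_mul (4 * M)).add (hb0.pow 2)).const_mul v
      simpa using this
    rw [tendsto_iff_norm_sub_tendsto_zero]
    refine squeeze_zero' (.of_forall fun n => norm_nonneg _) ?_ hbd
    filter_upwards [eventually_ge_atTop 3] with n hn
    have hne : (s n).Nonempty := Finset.card_pos.1 (by exact_mod_cast (hcard n hn).1)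
    exact abs_integral_cosMean_sub_le hne (fun j : Fin n => hX j) (hXn n) (fun j => hmean j)
      (fun j => hvar j) (fun j => hint j) (fun j => hM j) (hb n) (by positivity) hM0 hv
      (fun k hk => by rw [h n k hk k hk, if_pos rfl]) α
  -- Integer truncation levels and tolerances `1/(q+1)` keep the intersection of almost sure events
  -- countable.
  have hall1 : ∀ᵐ ω ∂P, ∀ (K q : ℕ), ∀ᶠ n in atTop,
      |Y (K + 1) n ω - ∫ ω', Y (K + 1) n ω' ∂P| < 1 / (q + 1) := by
    refine ae_all_iff.2 fun K => ae_all_iff.2 fun q => ?_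
    exact hconc _ (by positivity) _ (by positivity)
  have hall2 : ∀ᵐ ω ∂P, ∀ K : ℕ, ∀ᶠ n : ℕ in atTop,
      (G n ω - Y (K + 1) n ω) ^ 2 ≤ 32 * v * ((M + 1) / (K + 1)) :=
    ae_all_iff.2 fun K => htail _ (by positivity)
  filter_upwards [hall1, hall2] with ω h1 h2
  rw [Metric.tendsto_nhds] at hclt ⊢
  intro ε hε
  obtain ⟨q, hq⟩ := exists_nat_one_div_lt (show 0 < ε / 4 by positivity)
  have hK : ∃ K : ℕ, 32 * v * ((M + 1) / ((K : ℝ) + 1)) < (ε / 4) ^ 2 := by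
    have ht : Tendsto (fun K : ℕ => 32 * v * (M + 1) * (1 / ((K : ℝ) + 1))) atTop (𝓝 0) := by
      simpa using (tendsto_one_div_add_atTop_nhds_zero_nat (𝕜 := ℝ)).const_mul
        (32 * v * (M + 1))
    obtain ⟨K, hK⟩ := (ht.eventually_lt_const (show 0 < (ε / 4) ^ 2 by positivity)).exists
    exact ⟨K, lt_of_eq_of_lt (by ring) hK⟩
  obtain ⟨K, hK⟩ := hK
  -- Four errors of at most `ε/4`: from `G` to `Y`, to its mean, to the mean of `G`, to the limit.
  filter_upwards [h1 K q, h2 K, hclt (ε / 4) (by positivity), eventually_ge_atTop 3]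
    with n e1 e2 e3 hn
  have e4 := hE (K + 1) (by positivity) n hn
  have e5 := abs_lt_of_sq_lt_sq (e2.trans_lt hK) (by positivity)
  have e6 := abs_lt_of_sq_lt_sq (e4.trans_lt hK) (by positivity)
  rw [Real.dist_eq] at e3 ⊢
  change |G n ω - _| < ε
  rw [abs_lt] at e1 e3 e5 e6 ⊢
  constructor <;> linarith [e1.1, e1.2, e3.1, e3.2, e5.1, e5.2, e6.1, e6.2]

end Concentration

/-! ### Orthogonality at the Fourier frequencies -/

lemma sum_cexp_fourier_eq_zero {n : ℕ} {m : ℤ} (hm : ¬ (n : ℤ) ∣ m) :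
    ∑ j : Fin n, Complex.exp ((((j : ℕ) + 1 : ℝ) * (2 * Real.pi * m / n) : ℝ) * Complex.I) = 0 := by
  rcases n.eq_zero_or_pos with rfl | hn
  · simp
  have hn0 : (n : ℂ) ≠ 0 := by exact_mod_cast hn.ne'
  set z := Complex.exp ((2 * Real.pi * m / n : ℝ) * Complex.I) with hz
  have hz1 : z ≠ 1 := by
    intro h
    obtain ⟨q, hq⟩ := Complex.exp_eq_one_iff.1 h
    apply hm
    refine ⟨q, ?_⟩
    have hpi : (Real.pi : ℂ) ≠ 0 := by exact_mod_cast Real.pi_ne_zero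
    push_cast at hq
    have h2 : (m : ℂ) = n * q := by
      field_simp at hq
      exact hq
    exact_mod_cast h2
  have hzn : z ^ n = 1 := by
    rw [hz, ← Complex.exp_nat_mul]
    refine Complex.exp_eq_one_iff.2 ⟨m, ?_⟩
    push_cast
    field_simp
  have h1 : ∀ j : Fin n, Complex.exp ((((j : ℕ) + 1 : ℝ) * (2 * Real.pi * m / n) : ℝ) * Complex.I)
      = z * z ^ (j : ℕ) := by
    intro j
    rw [hz, ← Complex.exp_nat_mul, ← Complex.exp_add]
    congr 1
    push_cast
    ring
  simp_rw [h1]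
  rw [← Finset.mul_sum, Fin.sum_univ_eq_sum_range (fun j => z ^ j) n, geom_sum_eq hz1, hzn]
  simp

lemma sum_cos_fourier_eq_zero {n : ℕ} {m : ℤ} (hm : ¬ (n : ℤ) ∣ m) :
    ∑ j : Fin n, Real.cos (((j : ℕ) + 1 : ℝ) * (2 * Real.pi * m / n)) = 0 := by
  have := congrArg Complex.re (sum_cexp_fourier_eq_zero hm)
  simpa only [Complex.re_sum, Complex.exp_ofReal_mul_I_re, Complex.zero_re] using this

lemma sum_sin_fourier_eq_zero {n : ℕ} {m : ℤ} (hm : ¬ (n : ℤ) ∣ m) :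
    ∑ j : Fin n, Real.sin (((j : ℕ) + 1 : ℝ) * (2 * Real.pi * m / n)) = 0 := by
  have := congrArg Complex.im (sum_cexp_fourier_eq_zero hm)
  simpa only [Complex.im_sum, Complex.exp_ofReal_mul_I_im, Complex.zero_im] using this

/-- The coefficients of the linear form `x ↦ ⟪Z, ξ⟫`, where `Z` is the normalized Fourier
coefficient of `x` at frequency `2πk/n`. -/
noncomputable def fourierCoeffForm (ξ : ℂ) (n : ℕ) (j : Fin n) (k : ℕ) : ℝ :=
  (1 / √n) * (ξ.re * Real.cos (((j : ℕ) + 1 : ℝ) * (2 * Real.pi * k / n))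
    - ξ.im * Real.sin (((j : ℕ) + 1 : ℝ) * (2 * Real.pi * k / n)))

lemma abs_fourierCoeffForm_le (ξ : ℂ) (n : ℕ) (j : Fin n) (k : ℕ) :
    |fourierCoeffForm ξ n j k| ≤ (|ξ.re| + |ξ.im|) / √n := by
  unfold fourierCoeffForm
  rw [abs_mul, abs_of_nonneg (by positivity), one_div, inv_mul_eq_div]
  gcongr
  refine (abs_sub _ _).trans ?_
  rw [abs_mul, abs_mul]
  exact add_le_add (mul_le_of_le_one_right (abs_nonneg _) (Real.abs_cos_le_one _))
    (mul_le_of_le_one_right (abs_nonneg _) (Real.abs_sin_le_one _))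

lemma fourierCoeffForm_sub (ξ η : ℂ) (n : ℕ) (j : Fin n) (k : ℕ) :
    fourierCoeffForm (ξ - η) n j k = fourierCoeffForm ξ n j k - fourierCoeffForm η n j k := by
  simp only [fourierCoeffForm, Complex.sub_re, Complex.sub_im]
  ring

/-- Orthogonality relations at the frequencies strictly between `0` and `π`. -/
lemma sum_fourierCoeffForm_mul (ξ : ℂ) (n : ℕ) :
    ∀ k ∈ Finset.Icc 1 (numFreq n), ∀ l ∈ Finset.Icc 1 (numFreq n),
      ∑ j, fourierCoeffForm ξ n j k * fourierCoeffForm ξ n j l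
        = if k = l then ‖ξ‖ ^ 2 / 2 else 0 := by
  intro k hk l hl
  simp only [Finset.mem_Icc, numFreq] at hk hl
  have hn : 0 < n := by omega
  have hn0 : (0 : ℝ) < n := by exact_mod_cast hn
  -- Product-to-sum formulas leave trigonometric sums at the frequencies `k - l` and `k + l` only.
  have hprod : ∀ j : Fin n, fourierCoeffForm ξ n j k * fourierCoeffForm ξ n j l
      = (1 / n) * ((‖ξ‖ ^ 2 / 2)
          * Real.cos (((j : ℕ) + 1 : ℝ) * (2 * Real.pi * ((k : ℤ) - l : ℤ) / n))
        + ((ξ.re ^ 2 - ξ.im ^ 2) / 2)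
          * Real.cos (((j : ℕ) + 1 : ℝ) * (2 * Real.pi * ((k : ℤ) + l : ℤ) / n))
        - (ξ.re * ξ.im)
          * Real.sin (((j : ℕ) + 1 : ℝ) * (2 * Real.pi * ((k : ℤ) + l : ℤ) / n))) := by
    intro j
    have e1 : ((j : ℕ) + 1 : ℝ) * (2 * Real.pi * ((k : ℤ) - l : ℤ) / n)
        = ((j : ℕ) + 1 : ℝ) * (2 * Real.pi * k / n)
          - ((j : ℕ) + 1 : ℝ) * (2 * Real.pi * l / n) := by push_cast; ring
    have e2 : ((j : ℕ) + 1 : ℝ) * (2 * Real.pi * ((k : ℤ) + l : ℤ) / n)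
        = ((j : ℕ) + 1 : ℝ) * (2 * Real.pi * k / n)
          + ((j : ℕ) + 1 : ℝ) * (2 * Real.pi * l / n) := by push_cast; ring
    have e3 : (1 / √(n : ℝ)) * (1 / √(n : ℝ)) = 1 / n := by
      rw [div_mul_div_comm, Real.mul_self_sqrt hn0.le, one_mul]
    have e4 : ‖ξ‖ ^ 2 = ξ.re ^ 2 + ξ.im ^ 2 := by
      rw [← Complex.normSq_eq_norm_sq, Complex.normSq_apply]; ring
    rw [e1, e2, Real.cos_sub, Real.cos_add, Real.sin_add, ← e3, e4]
    simp only [fourierCoeffForm]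
    ring
  -- Here `0 < k + l ≤ 2⌊(n-1)/2⌋ < n`; this is where excluding the frequencies `0` and `π` matters.
  have hplus : ¬ (n : ℤ) ∣ ((k : ℤ) + l) := by
    intro h
    have := Int.le_of_dvd (by omega) h
    omega
  simp_rw [hprod]
  rw [← Finset.mul_sum, Finset.sum_sub_distrib, Finset.sum_add_distrib, ← Finset.mul_sum,
    ← Finset.mul_sum, ← Finset.mul_sum, sum_cos_fourier_eq_zero hplus,
    sum_sin_fourier_eq_zero hplus]
  split_ifs with hkl
  · subst hkl
    simp
    field_simp
  · have hminus : ¬ (n : ℤ) ∣ ((k : ℤ) - l) := by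
      intro h
      have h0 : (k : ℤ) - l ≠ 0 := by omega
      have := Int.le_of_dvd (abs_pos.2 h0) ((dvd_abs _ _).2 h)
      have h3 : |(k : ℤ) - l| < n := by rw [abs_lt]; constructor <;> omega
      omega
    rw [sum_cos_fourier_eq_zero hminus]
    simp

/-- The Fourier coefficient `n^{-1/2} ∑_j e^{-ijθ} x_j` at `θ = 2πk/n`. -/
noncomputable def fourierCoefficient (x : ℕ → ℝ) (n k : ℕ) : ℂ :=
  (1 / √n : ℝ) * ∑ j ∈ Finset.range n,
    Complex.exp (-Complex.I * ((j + 1 : ℕ) : ℂ) * ((2 * Real.pi * (k : ℝ) / (n : ℝ) : ℝ) : ℂ))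
      * (x j : ℂ)

lemma norm_fourierCoefficient_sq (x : ℕ → ℝ) (n k : ℕ) :
    ‖fourierCoefficient x n k‖ ^ 2 = periodogram x n (2 * Real.pi * (k : ℝ) / (n : ℝ)) := by
  rw [fourierCoefficient, periodogram, norm_mul, mul_pow, Complex.norm_real, Real.norm_eq_abs,
    sq_abs, div_pow, Real.sq_sqrt (Nat.cast_nonneg n), one_pow]

lemma inner_fourierCoefficient (x : ℕ → ℝ) (n k : ℕ) (ξ : ℂ) :
    inner ℝ (fourierCoefficient x n k) ξ = ∑ j : Fin n, fourierCoeffForm ξ n j k * x j := by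
  have h : ∀ j : ℕ, Complex.exp (-Complex.I * ((j + 1 : ℕ) : ℂ)
      * ((2 * Real.pi * (k : ℝ) / (n : ℝ) : ℝ) : ℂ))
      = Complex.exp ((-((j + 1 : ℝ) * (2 * Real.pi * k / n)) : ℝ) * Complex.I) := by
    intro j
    congr 1
    push_cast
    ring
  have hre : (fourierCoefficient x n k).re = ∑ j : Fin n,
      (1 / √n) * (Real.cos (((j : ℕ) + 1 : ℝ) * (2 * Real.pi * k / n)) * x j) := by
    rw [fourierCoefficient, Complex.re_ofReal_mul, Complex.re_sum, Finset.sum_range,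
      Finset.mul_sum]
    refine Finset.sum_congr rfl fun j _ => ?_
    rw [h, Complex.re_mul_ofReal, Complex.exp_ofReal_mul_I_re, Real.cos_neg]
  have him : (fourierCoefficient x n k).im = ∑ j : Fin n,
      (1 / √n) * (-Real.sin (((j : ℕ) + 1 : ℝ) * (2 * Real.pi * k / n)) * x j) := by
    rw [fourierCoefficient, Complex.im_ofReal_mul, Complex.im_sum, Finset.sum_range,
      Finset.mul_sum]
    refine Finset.sum_congr rfl fun j _ => ?_
    rw [h, Complex.im_mul_ofReal, Complex.exp_ofReal_mul_I_im, Real.sin_neg]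
  rw [Complex.inner]
  simp only [Complex.mul_re, Complex.conj_re, Complex.conj_im]
  rw [hre, him, mul_neg, sub_neg_eq_add, Finset.mul_sum, Finset.mul_sum, ← Finset.sum_add_distrib]
  refine Finset.sum_congr rfl fun j _ => ?_
  simp only [fourierCoeffForm]
  ring

/-! ### The limiting circular Gaussian law -/

/-- The circular complex Gaussian law, with density `π⁻¹ exp (-‖z‖ ^ 2)`. -/
noncomputable def circularGaussian : Measure ℂ :=
  volume.withDensity fun z => ENNReal.ofReal (Real.pi⁻¹ * Real.exp (-‖z‖ ^ 2))

lemma integral_circularGaussian {E : Type*} [NormedAddCommGroup E] [NormedSpace ℝ E] (f : ℂ → E) :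
    ∫ z, f z ∂circularGaussian = ∫ z, (Real.pi⁻¹ * Real.exp (-‖z‖ ^ 2)) • f z := by
  rw [circularGaussian, integral_withDensity_eq_integral_toReal_smul (by fun_prop)
    (.of_forall fun z => ENNReal.ofReal_lt_top)]
  refine integral_congr_ae (.of_forall fun z => ?_)
  simp only
  rw [ENNReal.toReal_ofReal (by have := Real.pi_pos; positivity)]

lemma integral_cexp_inner_circularGaussian (t : ℂ) :
    ∫ z, Complex.exp (inner ℝ z t * Complex.I) ∂circularGaussian = Real.exp (-(‖t‖ ^ 2 / 4)) := by
  rw [integral_circularGaussian]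
  have h := GaussianFourier.integral_cexp_neg_mul_sq_norm_add (V := ℂ) (b := 1) (by simp)
    Complex.I t
  have hpi : (Real.pi : ℂ) ≠ 0 := by exact_mod_cast Real.pi_ne_zero
  have h1 : ∀ z : ℂ, (Real.pi⁻¹ * Real.exp (-‖z‖ ^ 2)) • Complex.exp (inner ℝ z t * Complex.I)
      = (Real.pi : ℂ)⁻¹ * Complex.exp (-1 * ‖z‖ ^ 2 + Complex.I * (inner ℝ t z : ℝ)) := by
    intro z
    rw [Complex.exp_add, real_inner_comm, Complex.real_smul]
    push_cast
    rw [mul_assoc, mul_comm Complex.I, neg_one_mul]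
  simp_rw [h1]
  rw [integral_const_mul, h, Complex.finrank_real_complex]
  push_cast
  rw [div_self two_ne_zero, Complex.cpow_one, div_one, ← mul_assoc, inv_mul_cancel₀ hpi, one_mul,
    Complex.I_sq]
  congr 1
  ring

instance : IsProbabilityMeasure circularGaussian := by
  have h := integral_cexp_inner_circularGaussian 0
  simp only [inner_zero_right, Complex.ofReal_zero, zero_mul, Complex.exp_zero, norm_zero] at h
  -- The total mass is read off the Fourier transform at `0`. Finiteness must come first; otherwise
  -- the integral of `1` would take its default value `0`, not `1`.
  have hfin : IsFiniteMeasure circularGaussian := by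
    by_contra hc
    have h0 : ∫ _z : ℂ, (1 : ℂ) ∂circularGaussian = 0 := by
      refine integral_undef fun hi => hc ?_
      rwa [integrable_const_iff_isFiniteMeasure one_ne_zero] at hi
    rw [h0] at h
    simp at h
  rw [integral_const] at h
  refine ⟨?_⟩
  have h2 : circularGaussian.real Set.univ = 1 := by
    have := congrArg Complex.re h
    simpa using this
  rw [measureReal_def, ENNReal.toReal_eq_one_iff] at h2
  exact h2

lemma charFun_circularGaussian (t : ℂ) :
    charFun circularGaussian t = Real.exp (-(‖t‖ ^ 2 / 4)) :=
  integral_cexp_inner_circularGaussian t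

/-- In polar coordinates the radial density is `2ρ e^{-ρ²}`, with primitive `-e^{-ρ²}`: the squared
modulus is exponential. -/
lemma circularGaussian_real_closedBall {r : ℝ} (hr : 0 ≤ r) :
    circularGaussian.real (Metric.closedBall 0 r) = 1 - Real.exp (-r ^ 2) := by
  have h1 : circularGaussian.real (Metric.closedBall 0 r)
      = ∫ z, (Metric.closedBall (0 : ℂ) r).indicator (fun _ => (1 : ℝ)) z ∂circularGaussian := by
    exact (integral_indicator_one Metric.isClosed_closedBall.measurableSet).symm
  rw [h1, integral_circularGaussian, ← Complex.integral_comp_polarCoord_symm]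
  have h2 : ∀ p ∈ polarCoord.target, p.1 • ((Real.pi⁻¹ * Real.exp (-‖Complex.polarCoord.symm p‖ ^ 2))
      • (Metric.closedBall (0 : ℂ) r).indicator (fun _ => (1 : ℝ)) (Complex.polarCoord.symm p))
      = (Set.Iic r).indicator (fun ρ => Real.pi⁻¹ * (ρ * Real.exp (-ρ ^ 2))) p.1 * 1 := by
    rintro ⟨ρ, φ⟩ hp
    have hρ : 0 < ρ := by simpa [polarCoord_target] using (And.left hp)
    have hn : ‖Complex.polarCoord.symm (ρ, φ)‖ = ρ := by
      rw [Complex.norm_polarCoord_symm, abs_of_pos hρ]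
    by_cases h : ρ ≤ r
    · rw [Set.indicator_of_mem (by simpa only [mem_closedBall_zero_iff, hn] using h), Set.indicator_of_mem (by simpa using h), hn]
      simp only [smul_eq_mul]
      ring
    · rw [Set.indicator_of_notMem (by simpa only [mem_closedBall_zero_iff, hn] using h),
        Set.indicator_of_notMem (by simpa using h)]
      simp
  rw [setIntegral_congr_fun (by exact polarCoord.open_target.measurableSet) h2, polarCoord_target,
    Measure.volume_eq_prod, setIntegral_prod_mul (fun ρ => (Set.Iic r).indicator
      (fun ρ => Real.pi⁻¹ * (ρ * Real.exp (-ρ ^ 2))) ρ) (fun _ : ℝ => (1 : ℝ))]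
  have h3 : ∫ _φ in Set.Ioo (-Real.pi) Real.pi, (1 : ℝ) = 2 * Real.pi := by
    rw [setIntegral_const, measureReal_def, Real.volume_Ioo, ENNReal.toReal_ofReal
      (by linarith [Real.pi_pos])]
    simp
    ring
  rw [h3, setIntegral_indicator measurableSet_Iic, Set.Ioi_inter_Iic,
    ← intervalIntegral.integral_of_le hr]
  have h4 : ∫ ρ in (0 : ℝ)..r, Real.pi⁻¹ * (ρ * Real.exp (-ρ ^ 2))
      = (-(Real.pi⁻¹ / 2) * Real.exp (-r ^ 2)) - (-(Real.pi⁻¹ / 2) * Real.exp (-(0 : ℝ) ^ 2)) := by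
    refine intervalIntegral.integral_eq_sub_of_hasDerivAt
      (f := fun ρ => -(Real.pi⁻¹ / 2) * Real.exp (-ρ ^ 2)) (fun ρ _ => ?_)
      (Continuous.intervalIntegrable (by fun_prop) _ _)
    have := (((hasDerivAt_pow 2 ρ).neg).exp).const_mul (-(Real.pi⁻¹ / 2))
    refine this.congr_deriv ?_
    simp
    ring
  rw [h4]
  have := Real.pi_pos
  field_simp
  simp
  ring

lemma circularGaussian_frontier_closedBall (r : ℝ) :
    circularGaussian (frontier (Metric.closedBall 0 r)) = 0 := by
  exact withDensity_absolutelyContinuous _ _ (measure_mono_null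
    Metric.frontier_closedBall_subset_sphere (Measure.addHaar_sphere _ _ _))

/-! ### From pointwise to uniform convergence -/

/-- Pólya's theorem for the exponential distribution: pointwise convergence of monotone functions
to its distribution function is uniform. -/
theorem eventually_forall_abs_sub_exp_cdf_le {f : ℕ → ℝ → ℝ} (hmono : ∀ n, Monotone (f n))
    (hle : ∀ n t, f n t ≤ 1)
    (h : ∀ t, 0 ≤ t → Tendsto (fun n => f n t) atTop (𝓝 (1 - Real.exp (-t)))) {ε : ℝ}
    (hε : 0 < ε) : ∀ᶠ n in atTop, ∀ t, 0 ≤ t → |f n t - (1 - Real.exp (-t))| ≤ ε := by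
  obtain ⟨q, hq⟩ := exists_nat_one_div_lt (show 0 < ε / 2 by positivity)
  set N : ℕ := q + 1 with hN
  have hN0 : (0 : ℝ) < N := by exact_mod_cast (by omega : 0 < N)
  have hq' : 1 / (N : ℝ) < ε / 2 := by simpa [hN] using hq
  -- Quantiles of levels `i/N`: between neighbours the limit grows by `1/N`, so monotonicity costs
  -- at most `2/N < ε`.
  set τ : ℕ → ℝ := fun i => -Real.log (1 - i / N) with hτ
  have hpos : ∀ i < N, (0 : ℝ) < 1 - i / N := by
    intro i hi
    rw [sub_pos, div_lt_one hN0]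
    exact_mod_cast hi
  have hexp : ∀ i < N, 1 - Real.exp (-τ i) = i / N := by
    intro i hi
    simp only [hτ, neg_neg]
    rw [Real.exp_log (hpos i hi)]
    ring
  have hτ0 : ∀ i < N, 0 ≤ τ i := by
    intro i hi
    simp only [hτ]
    rw [neg_nonneg]
    exact Real.log_nonpos (hpos i hi).le (by have : (0 : ℝ) ≤ i / N := by positivity
                                             linarith)
  have hev : ∀ᶠ n in atTop, ∀ i ∈ Finset.range N, |f n (τ i) - i / N| < 1 / N := by
    rw [eventually_all_finset]
    intro i hi
    have hi' := Finset.mem_range.1 hi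
    have := h (τ i) (hτ0 i hi')
    rw [hexp i hi'] at this
    exact Metric.tendsto_nhds.1 this (1 / N) (by positivity)
  filter_upwards [hev] with n hn t ht
  set F := 1 - Real.exp (-t) with hF
  have hF0 : 0 ≤ F := by
    have := Real.exp_le_one_iff.2 (neg_nonpos.2 ht)
    linarith
  have hF1 : F < 1 := by linarith [Real.exp_pos (-t)]
  set i := ⌊N * F⌋₊ with hi
  have hi1 : (i : ℝ) ≤ N * F := Nat.floor_le (by positivity)
  have hi2 : N * F < i + 1 := Nat.lt_floor_add_one _
  have hiN : i < N := by
    have : (i : ℝ) < N := hi1.trans_lt (by nlinarith)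
    exact_mod_cast this
  have hle1 : (i : ℝ) / N ≤ F := by rw [div_le_iff₀ hN0]; linarith
  have hlt1 : F < (i : ℝ) / N + 1 / N := by
    rw [← add_div, lt_div_iff₀ hN0]; linarith
  have hτi : τ i ≤ t := by
    have : Real.exp (-t) ≤ Real.exp (-τ i) := by linarith [hexp i hiN]
    linarith [Real.exp_le_exp.1 this]
  have hlow := (abs_lt.1 (hn i (Finset.mem_range.2 hiN))).1
  have hm1 := hmono n hτi
  rw [abs_le]
  refine ⟨by linarith, ?_⟩
  rcases Nat.lt_or_ge (i + 1) N with h1 | h1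
  · have hτi1 : t ≤ τ (i + 1) := by
      have h2 := hexp (i + 1) h1
      push_cast at h2
      rw [add_div] at h2
      have : Real.exp (-τ (i + 1)) ≤ Real.exp (-t) := by linarith
      linarith [Real.exp_le_exp.1 this]
    have hup := (abs_lt.1 (hn (i + 1) (Finset.mem_range.2 h1))).2
    have hm2 := hmono n hτi1
    push_cast at hup
    rw [add_div] at hup
    linarith
  -- The last cell has no finite right quantile; `f n t ≤ 1` replaces it.
  · have h2 : (N : ℝ) ≤ i + 1 := by exact_mod_cast h1
    have h3 : 1 ≤ (i : ℝ) / N + 1 / N := by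
      rw [← add_div, le_div_iff₀ hN0]; linarith
    linarith [hle n t]

/-! ### All directions simultaneously -/

/-- Bessel applied to the difference family. For Fourier forms, linearity in `ξ` makes that
difference again a Fourier form, hence orthogonal. -/
lemma sq_cosMean_sub_coeff_le {ι κ : Type*} [Fintype ι] [DecidableEq κ] {s : Finset κ}
    {a a' : ι → κ → ℝ} {v : ℝ} (hv : 0 ≤ v)
    (h : ∀ k ∈ s, ∀ l ∈ s, ∑ j, (a j k - a' j k) * (a j l - a' j l) = if k = l then v else 0)
    (α : ℝ) (x : ι → ℝ) :
    (cosMean s a α x - cosMean s a' α x) ^ 2 ≤ v / s.card * ∑ j, x j ^ 2 := by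
  have h1 : cosMean s a α x - cosMean s a' α x = (1 / (s.card : ℝ)) * ∑ k ∈ s,
      (Real.cos (∑ j, a j k * x j + α) - Real.cos (∑ j, a' j k * x j + α)) := by
    simp only [cosMean]
    rw [← mul_sub, Finset.sum_sub_distrib]
  rw [h1]
  refine (sq_mean_le _).trans ?_
  have h2 : ∑ k ∈ s, (Real.cos (∑ j, a j k * x j + α) - Real.cos (∑ j, a' j k * x j + α)) ^ 2
      ≤ ∑ k ∈ s, (∑ j, (a j k - a' j k) * x j) ^ 2 := by
    refine Finset.sum_le_sum fun k _ => ?_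
    rw [sq_le_sq]
    refine (Real.abs_cos_sub_cos_le _ _).trans (le_of_eq ?_)
    congr 1
    simp_rw [sub_mul, Finset.sum_sub_distrib]
    ring
  calc _ ≤ (1 / (s.card : ℝ)) * (v * ∑ j, x j ^ 2) := by
        gcongr
        exact h2.trans (bessel_of_orthogonal (a := fun j k => a j k - a' j k) hv h x)
    _ = _ := by ring

lemma le_four_mul_numFreq {n : ℕ} (hn : 3 ≤ n) : n ≤ 4 * (Finset.Icc 1 (numFreq n)).card := by
  rw [Nat.card_Icc, numFreq]
  omega

section Periodogram

variable {Ω : Type*} [MeasurableSpace Ω] {P : Measure Ω} [IsProbabilityMeasure P]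

/-- Almost surely, the averages of cosines over the Fourier frequencies converge for all directions
at once. -/
theorem ae_forall_tendsto_cosMean_fourier {X : ℕ → Ω → ℝ} (hX : ∀ j, Measurable (X j))
    (hindep : iIndepFun X P)
    (hmean : ∀ j, ∫ ω, X j ω ∂P = 0) (hvar : ∀ j, ∫ ω, X j ω ^ 2 ∂P = 1)
    {M : ℝ} (hint : ∀ j, Integrable (fun ω => |X j ω| ^ 3) P)
    (hM : ∀ j, ∫ ω, |X j ω| ^ 3 ∂P ≤ M) (α : ℝ) :
    ∀ᵐ ω ∂P, ∀ ξ : ℂ, Tendsto (fun n => cosMean (Finset.Icc 1 (numFreq n))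
      (fourierCoeffForm ξ n) α (fun j : Fin n => X j ω)) atTop
      (𝓝 (Real.cos α * Real.exp (-(‖ξ‖ ^ 2 / 2 / 2)))) := by
  have h1 : ∀ᵐ ω ∂P, ∀ i : ℕ, Tendsto (fun n => cosMean (Finset.Icc 1 (numFreq n))
      (fourierCoeffForm (TopologicalSpace.denseSeq ℂ i) n) α (fun j : Fin n => X j ω)) atTop
      (𝓝 (Real.cos α * Real.exp (-(‖TopologicalSpace.denseSeq ℂ i‖ ^ 2 / 2 / 2)))) :=
    ae_all_iff.2 fun i => ae_tendsto_cosMean hX hindep hmean hvar hint hM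
      (fun n hn => le_four_mul_numFreq hn) (by positivity)
      (B := |(TopologicalSpace.denseSeq ℂ i).re| + |(TopologicalSpace.denseSeq ℂ i).im|)
      (by positivity) (fun n => sum_fourierCoeffForm_mul _ n)
      (fun n j k _ => abs_fourierCoeffForm_le _ n j k) α
  -- At level `K = 0` the tail is the whole square, so the law of large numbers eventually bounds `∑
  -- X_j²` by `8n`.
  have hsq : ∀ j, ∫ ω, sqTail 0 (X j ω) ∂P ≤ 1 := by
    intro j
    rw [← hvar j]
    exact integral_mono (integrable_sqTail (hX j) (hint j) 0)
      (integrable_pow_of_integrable_abs_pow_three (hX j) (hint j)).2 fun ω => sqTail_le_sq _ _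
  have hsq0 : ∀ x : ℝ, sqTail 0 x = x ^ 2 := by
    intro x
    unfold sqTail
    split_ifs with h
    · rfl
    · have : x = 0 := by simpa using h
      simp [this]
  filter_upwards [h1, ae_eventually_sum_sqTail_le hX hindep hint hM zero_lt_one hsq]
    with ω hω hS ξ
  simp only [hsq0] at hS
  rw [Metric.tendsto_nhds]
  intro ε hε
  set c : ℂ → ℝ := fun ξ => Real.cos α * Real.exp (-(‖ξ‖ ^ 2 / 2 / 2)) with hc
  have hcc : Continuous c := by fun_prop
  obtain ⟨δ, hδ, hδc⟩ := Metric.continuous_iff.1 hcc ξ (ε / 3) (by positivity)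
  -- The averages differ by at most `4‖ξ - η‖`, as `½ · 8 · 4 = 4²`; hence `ε/12` for an error below
  -- `ε/3`.
  obtain ⟨i, hi⟩ := Metric.denseRange_iff.1 (TopologicalSpace.denseRange_denseSeq ℂ) ξ
    (min δ (ε / 12)) (by positivity)
  set η := TopologicalSpace.denseSeq ℂ i
  have hη1 := hδc η (by rw [dist_comm]; exact hi.trans_le (min_le_left _ _))
  have hη2 : ‖ξ - η‖ < ε / 12 := by
    rw [← dist_eq_norm]
    exact hi.trans_le (min_le_right _ _)
  filter_upwards [hS, Metric.tendsto_nhds.1 (hω i) (ε / 3) (by positivity), eventually_ge_atTop 3]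
    with n hn1 hn2 hn3
  have hn0 : (0 : ℝ) < n := by exact_mod_cast (by omega : 0 < n)
  have hcard : (n : ℝ) ≤ 4 * (Finset.Icc 1 (numFreq n)).card := by
    exact_mod_cast le_four_mul_numFreq hn3
  have hcard0 : (0 : ℝ) < (Finset.Icc 1 (numFreq n)).card := by linarith
  have hdiff := sq_cosMean_sub_coeff_le (s := Finset.Icc 1 (numFreq n))
    (a := fourierCoeffForm ξ n) (a' := fourierCoeffForm η n) (v := ‖ξ - η‖ ^ 2 / 2)
    (by positivity) (by
      simp only [← fourierCoeffForm_sub]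
      exact sum_fourierCoeffForm_mul (ξ - η) n) α (fun j : Fin n => X j ω)
  have hdiff2 : (cosMean (Finset.Icc 1 (numFreq n)) (fourierCoeffForm ξ n) α
      (fun j : Fin n => X j ω) - cosMean (Finset.Icc 1 (numFreq n)) (fourierCoeffForm η n) α
      (fun j : Fin n => X j ω)) ^ 2 < (ε / 3) ^ 2 := by
    calc _ ≤ ‖ξ - η‖ ^ 2 / 2 / (Finset.Icc 1 (numFreq n)).card * (8 * 1 * n) := by
          refine hdiff.trans ?_
          rw [← Finset.sum_range (fun j => X j ω ^ 2)]
          gcongr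
      _ = 4 * ‖ξ - η‖ ^ 2 * (n / (Finset.Icc 1 (numFreq n)).card) := by ring
      _ ≤ 4 * ‖ξ - η‖ ^ 2 * 4 := by
          gcongr
          rwa [div_le_iff₀ hcard0]
      _ = (4 * ‖ξ - η‖) ^ 2 := by ring
      _ < (ε / 3) ^ 2 := by
          have := norm_nonneg (ξ - η)
          exact pow_lt_pow_left₀ (by linarith) (by positivity) two_ne_zero
  have hdiff3 := abs_lt_of_sq_lt_sq hdiff2 (by positivity)
  rw [Real.dist_eq] at hη1 hn2 ⊢
  change |_ - c ξ| < ε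
  change |_ - c η| < ε / 3 at hn2
  rw [abs_lt] at hη1 hn2 hdiff3 ⊢
  constructor <;> linarith [hη1.1, hη1.2, hn2.1, hn2.2, hdiff3.1, hdiff3.2]

end Periodogram

/-! ### Empirical measures and Lévy's theorem -/

/-- The uniform probability on the values of a finite family. -/
noncomputable def empiricalMeasure {κ E : Type*} [MeasurableSpace E] (s : Finset κ) (Z : κ → E) :
    Measure E :=
  (s.card : ENNReal)⁻¹ • ∑ k ∈ s, Measure.dirac (Z k)

lemma isProbabilityMeasure_empiricalMeasure {κ E : Type*} [MeasurableSpace E] {s : Finset κ}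
    (hs : s.Nonempty) (Z : κ → E) : IsProbabilityMeasure (empiricalMeasure s Z) := by
  refine ⟨?_⟩
  simp only [empiricalMeasure, Measure.smul_apply, Measure.finsetSum_apply, measure_univ,
    Finset.sum_const, nsmul_eq_mul, mul_one, smul_eq_mul]
  exact ENNReal.inv_mul_cancel (by exact_mod_cast hs.card_pos.ne') (ENNReal.natCast_ne_top _)

lemma integral_empiricalMeasure {κ E F : Type*} [MeasurableSpace E] [NormedAddCommGroup F]
    [NormedSpace ℝ F] [CompleteSpace F] (s : Finset κ) (Z : κ → E)
    {f : E → F} (hf : StronglyMeasurable f) :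
    ∫ z, f z ∂(empiricalMeasure s Z) = (1 / (s.card : ℝ)) • ∑ k ∈ s, f (Z k) := by
  rw [empiricalMeasure, integral_smul_measure, integral_finsetSum_measure]
  · simp [integral_dirac' _ _ hf]
  · intro k _
    exact integrable_dirac' hf enorm_lt_top

lemma empiricalMeasure_real_apply {κ E : Type*} [MeasurableSpace E] (s : Finset κ) (Z : κ → E)
    {A : Set E} (hA : MeasurableSet A) [DecidablePred (· ∈ A)] :
    (empiricalMeasure s Z).real A
      = (1 / (s.card : ℝ)) * ∑ k ∈ s, if Z k ∈ A then (1 : ℝ) else 0 := by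
  rw [← integral_indicator_one hA, integral_empiricalMeasure s Z
    (stronglyMeasurable_one.indicator hA), smul_eq_mul]
  congr 1
  refine Finset.sum_congr rfl fun k _ => ?_
  by_cases h : Z k ∈ A <;> simp [h]

/-- The phase `-π/2` turns cosine into sine, so one family of averages covers both parts of the
characteristic function. -/
lemma charFun_empiricalMeasure_fourier (x : ℕ → ℝ) (n : ℕ) (ξ : ℂ) :
    charFun (empiricalMeasure (Finset.Icc 1 (numFreq n)) (fourierCoefficient x n)) ξ
      = (cosMean (Finset.Icc 1 (numFreq n)) (fourierCoeffForm ξ n) 0 (fun j : Fin n => x j) : ℂ)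
        + (cosMean (Finset.Icc 1 (numFreq n)) (fourierCoeffForm ξ n) (-(Real.pi / 2))
          (fun j : Fin n => x j) : ℂ) * Complex.I := by
  rw [charFun_apply, integral_empiricalMeasure _ _ (by
    refine Continuous.stronglyMeasurable ?_
    fun_prop)]
  simp only [inner_fourierCoefficient, cosMean, add_zero, ← sub_eq_add_neg,
    Real.cos_sub_pi_div_two]
  rw [Complex.real_smul]
  push_cast
  rw [mul_assoc, ← mul_add, Finset.sum_mul, ← Finset.sum_add_distrib]
  congr 1
  refine Finset.sum_congr rfl fun k _ => ?_
  rw [Complex.exp_mul_I]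

lemma periodogramCDF_eq_empiricalMeasure (x : ℕ → ℝ) (n : ℕ) {t : ℝ} (ht : 0 ≤ t) :
    periodogramCDF x n t
      = (empiricalMeasure (Finset.Icc 1 (numFreq n)) (fourierCoefficient x n)).real
        (Metric.closedBall 0 √t) := by
  classical
  rw [empiricalMeasure_real_apply _ _ Metric.isClosed_closedBall.measurableSet, periodogramCDF]
  simp only [Nat.card_Icc, Nat.add_sub_cancel]
  congr 1
  refine Finset.sum_congr rfl fun k _ => ?_
  rw [← norm_fourierCoefficient_sq, mem_closedBall_zero_iff, Real.le_sqrt (norm_nonneg _) ht]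

lemma periodogramCDF_mono (x : ℕ → ℝ) (n : ℕ) : Monotone (periodogramCDF x n) := by
  intro s t hst
  unfold periodogramCDF
  gcongr with k _
  split_ifs with h1 h2
  · exact le_rfl
  · exact absurd (h1.trans hst) h2
  · exact zero_le_one
  · exact le_rfl

lemma periodogramCDF_le_one (x : ℕ → ℝ) (n : ℕ) (t : ℝ) : periodogramCDF x n t ≤ 1 := by
  have h := abs_mean_le (s := Finset.Icc 1 (numFreq n))
    (f := fun k : ℕ => if periodogram x n (2 * Real.pi * (k : ℝ) / (n : ℝ)) ≤ t then (1 : ℝ) else 0)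
    zero_le_one (fun k _ => by split_ifs <;> simp)
  rw [Nat.card_Icc, Nat.add_sub_cancel] at h
  exact (le_abs_self _).trans h

/-- Lévy's theorem for the empirical measures of the Fourier coefficients of a fixed sequence. -/
lemma tendsto_periodogramCDF_of_tendsto_charFun {x : ℕ → ℝ}
    (h : ∀ ξ : ℂ, Tendsto (fun n => charFun (empiricalMeasure (Finset.Icc 1 (numFreq n))
      (fourierCoefficient x n)) ξ) atTop (𝓝 (Real.exp (-(‖ξ‖ ^ 2 / 4)) : ℝ))) {t : ℝ}
    (ht : 0 ≤ t) : Tendsto (fun n => periodogramCDF x n t) atTop (𝓝 (1 - Real.exp (-t))) := by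
  -- Indices start at `3`, so that there is at least one frequency and the empirical measure has
  -- mass `1`.
  set μ : ℕ → ProbabilityMeasure ℂ := fun n =>
    ⟨empiricalMeasure (Finset.Icc 1 (numFreq (n + 3))) (fourierCoefficient x (n + 3)),
      isProbabilityMeasure_empiricalMeasure
        (Finset.nonempty_Icc.2 (by rw [numFreq]; omega)) _⟩ with hμ
  set μ₀ : ProbabilityMeasure ℂ := ⟨circularGaussian, inferInstance⟩
  have hconv : Tendsto μ atTop (𝓝 μ₀) := by
    refine ProbabilityMeasure.tendsto_of_tendsto_charFun fun ξ => ?_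
    change Tendsto _ _ (𝓝 (charFun circularGaussian ξ))
    rw [charFun_circularGaussian]
    exact (h ξ).comp (tendsto_add_atTop_nat 3)
  have hball := ProbabilityMeasure.tendsto_measure_of_null_frontier_of_tendsto' hconv
    (E := Metric.closedBall 0 √t) (circularGaussian_frontier_closedBall _)
  have hreal := (ENNReal.tendsto_toReal (measure_ne_top _ _)).comp hball
  have hlim : (circularGaussian (Metric.closedBall 0 √t)).toReal = 1 - Real.exp (-t) := by
    have := circularGaussian_real_closedBall (Real.sqrt_nonneg t)
    rwa [Real.sq_sqrt ht] at this
  change Tendsto _ _ (𝓝 (circularGaussian (Metric.closedBall 0 √t)).toReal) at hreal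
  rw [hlim] at hreal
  rw [← tendsto_add_atTop_iff_nat 3]
  refine hreal.congr fun n => ?_
  rw [periodogramCDF_eq_empiricalMeasure _ _ ht]
  rfl

theorem corollary1 {Ω : Type*} [MeasurableSpace Ω] (P : Measure Ω) [IsProbabilityMeasure P]
    (X : ℕ → Ω → ℝ) (hmeas : ∀ j, Measurable (X j)) (hindep : iIndepFun X P)
    (hmean : ∀ j, ∫ ω, X j ω ∂P = 0) (hvar : ∀ j, ∫ ω, X j ω ^ 2 ∂P = 1)
    (M : ℝ) (hint : ∀ j, Integrable (fun ω => |X j ω| ^ 3) P)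
    (hthird : ∀ j, ∫ ω, |X j ω| ^ 3 ∂P ≤ M) :
    ∀ᵐ ω ∂P, Tendsto
      (fun n : ℕ => ⨆ t : Set.Ici (0 : ℝ),
        |periodogramCDF (fun j => X j ω) n (t : ℝ) - (1 - Real.exp (-(t : ℝ)))|)
      atTop (𝓝 0) := by
  filter_upwards [ae_forall_tendsto_cosMean_fourier hmeas hindep hmean hvar hint hthird 0,
    ae_forall_tendsto_cosMean_fourier hmeas hindep hmean hvar hint hthird (-(Real.pi / 2))]
    with ω hre him
  have hchar : ∀ ξ : ℂ, Tendsto (fun n => charFun (empiricalMeasure (Finset.Icc 1 (numFreq n))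
      (fourierCoefficient (fun j => X j ω) n)) ξ) atTop
      (𝓝 (Real.exp (-(‖ξ‖ ^ 2 / 4)) : ℝ)) := by
    intro ξ
    simp_rw [charFun_empiricalMeasure_fourier]
    have h1 := (Complex.continuous_ofReal.tendsto _).comp (hre ξ)
    have h2 := (Complex.continuous_ofReal.tendsto _).comp (him ξ)
    have h3 := h1.add (h2.mul_const Complex.I)
    -- The imaginary part tends to `0` because `cos(-π/2) = 0`.
    rw [Real.cos_neg, Real.cos_pi_div_two, Real.cos_zero, zero_mul, one_mul, div_div] at h3
    norm_num at h3
    simpa using h3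
  rw [Metric.tendsto_nhds]
  intro ε hε
  filter_upwards [eventually_forall_abs_sub_exp_cdf_le (fun n => periodogramCDF_mono _ n)
    (fun n t => periodogramCDF_le_one _ n t)
    (fun t ht => tendsto_periodogramCDF_of_tendsto_charFun hchar ht) (half_pos hε)] with n hn
  rw [Real.dist_eq, sub_zero, abs_of_nonneg (Real.iSup_nonneg fun t => abs_nonneg _)]
  exact (ciSup_le fun t : Set.Ici (0 : ℝ) => hn t t.2).trans_lt (half_lt_self hε)
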